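/- Let $\Bbbk$ be an algebraically closed field of characteristic zero and let $\widetilde{Q}$ be an extended Dynkin quiver, that is, a finite quiver (with any orientation) whose underlying graph is of type $\widetilde{\mathbb{A}}_n$ ($n\geq 1$; for $n=1$ two vertices joined by two edges), $\widetilde{\mathbb{D}}_n$ ($n\geq 4$), $\widetilde{\mathbb{E}}_6$, $\widetilde{\mathbb{E}}_7$ or $\widetilde{\mathbb{E}}_8$, with extending vertex $0$ (any vertex in type $\widetilde{\mathbb{A}}$, a leaf in type $\widetilde{\mathbb{D}}$, the end of a longest arm in type $\widetilde{\mathbb{E}}$). For a weight $\lambda\in\Bbbk^{\widetilde{Q}_0}$ let $\Pi^\lambda$ be the deformed preprojective algebra, i.e. the quotient of the path algebra (paths composed from left to right) of the double of $\widetilde{Q}$ by the two-sided ideal generated by the elements $$\sum_{t(\alpha)=i}\alpha\overline{\alpha}-\sum_{h(\alpha)=i}\overline{\alpha}\alpha-\lambda_i e_i,\qquad i\in\widetilde{Q}_0,$$ where $\alpha$ runs over the arrows of $\widetilde{Q}$, with tail $t(\alpha)$ and head $h(\alpha)$, and $\overline{\alpha}$ is the reverse arrow of $\alpha$. Put $\mathcal{O}^\lambda=e_0\Pi^\lambda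 e_0$ and let $V_i=e_i\Pi^\lambda e_0$, a right $\mathcal{O}^\lambda$-module, for each vertex $i$. Let $\lambda=\varepsilon_0$, that is, $\lambda_0=1$ and $\lambda_i=0$ for $i\neq 0$. Then for every vertex $i\neq 0$ of $\widetilde{Q}$ there is a short exact sequence of right $\mathcal{O}^\lambda$-modules $$0\to V_i\to\bigoplus_{k} V_k\to V_i\to 0,$$ where the direct sum has one summand $V_k$ for each edge of the underlying graph joining $i$ to a vertex $k$. (Thus $k$ runs over the vertices adjacent to $i$, each occurring once, except that in type $\widetilde{\mathbb{A}}_1$ the only neighbour $k=0$ of $i$ occurs twice.) -/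

import Mathlib

open scoped DirectSum

/-! ### Path algebras -/

/-- The set of all paths of a quiver, trivial paths included: triples (tail, head, path).
Paths are composed from left to right. -/
abbrev QuiverPath (W : Type*) [Quiver W] : Type _ :=
  Σ a : W, Σ b : W, Quiver.Path a b

/-- The path algebra `k W`: the free `k`-module on the set of all paths. -/
def PathAlgebra (k : Type*) (W : Type*) [Field k] [Quiver W] : Type _ :=
  QuiverPath W →₀ k

namespace PathAlgebra

section

variable {k : Type*} {W : Type*} [Field k] [Quiver W]

noncomputable instance : AddCommGroup (PathAlgebra k W) :=
  inferInstanceAs (AddCommGroup (QuiverPath W →₀ k))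

noncomputable instance : Module k (PathAlgebra k W) :=
  inferInstanceAs (Module k (QuiverPath W →₀ k))

/-- The basis element of `k W` given by a path. -/
noncomputable def ofPath {a b : W} (p : Quiver.Path a b) : PathAlgebra k W :=
  Finsupp.single (⟨a, b, p⟩ : QuiverPath W) (1 : k)

open Classical in
/-- The product of two paths `p` and `q`: their concatenation `pq` if the head of `p` is the
tail of `q`, and `0` otherwise. -/
noncomputable def pathMul (p q : QuiverPath W) : PathAlgebra k W :=
  if h : q.1 = p.2.1 then ofPath (p.2.2.comp (q.2.2.cast h rfl)) else 0

/-- The bilinear extension of the product of paths. -/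
noncomputable def mulMap : PathAlgebra k W →ₗ[k] PathAlgebra k W →ₗ[k] PathAlgebra k W :=
  Finsupp.linearCombination k fun p : QuiverPath W =>
    (Finsupp.linearCombination k (pathMul p) : (QuiverPath W →₀ k) →ₗ[k] PathAlgebra k W)

noncomputable instance : Mul (PathAlgebra k W) := ⟨fun x y => mulMap x y⟩

theorem mul_def (x y : PathAlgebra k W) : x * y = mulMap x y := rfl

@[elab_as_elim]
theorem induction {P : PathAlgebra k W → Prop} (x : PathAlgebra k W) (zero : P 0)
    (add : ∀ x y, P x → P y → P (x + y))
    (smul : ∀ (c : k) (a b : W) (p : Quiver.Path a b), P (c • ofPath p)) : P x := by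
  refine Finsupp.induction_linear (motive := P) x zero add ?_
  rintro ⟨a, b, p⟩ c
  have h := smul c a b p
  have e : (c • ofPath p : PathAlgebra k W) = Finsupp.single (⟨a, b, p⟩ : QuiverPath W) c :=
    (Finsupp.smul_single_one _ _)
  rwa [e] at h

theorem ofPath_mul' {a b c d : W} (p : Quiver.Path a b) (q : Quiver.Path c d) :
    (ofPath p * ofPath q : PathAlgebra k W) = pathMul ⟨a, b, p⟩ ⟨c, d, q⟩ := by
  rw [mul_def, mulMap, ofPath, ofPath]
  erw [Finsupp.linearCombination_single, one_smul, Finsupp.linearCombination_single, one_smul]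

@[simp]
theorem ofPath_mul_ofPath {a b c : W} (p : Quiver.Path a b) (q : Quiver.Path b c) :
    (ofPath p * ofPath q : PathAlgebra k W) = ofPath (p.comp q) := by
  rw [ofPath_mul', pathMul, dif_pos rfl]
  rfl

theorem ofPath_mul_of_ne {a b c d : W} (p : Quiver.Path a b) (q : Quiver.Path c d)
    (h : b ≠ c) : (ofPath p * ofPath q : PathAlgebra k W) = 0 := by
  rw [ofPath_mul', pathMul, dif_neg (fun h' => h h'.symm)]

protected theorem add_mul (x y z : PathAlgebra k W) : (x + y) * z = x * z + y * z := by
  simp only [mul_def, map_add, LinearMap.add_apply]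

protected theorem mul_add (x y z : PathAlgebra k W) : x * (y + z) = x * y + x * z := by
  simp only [mul_def, map_add]

protected theorem zero_mul (x : PathAlgebra k W) : 0 * x = 0 := by
  simp only [mul_def, map_zero, LinearMap.zero_apply]

protected theorem mul_zero (x : PathAlgebra k W) : x * 0 = 0 := by
  simp only [mul_def, map_zero]

protected theorem smul_mul (c : k) (x y : PathAlgebra k W) : (c • x) * y = c • (x * y) := by
  simp only [mul_def, map_smul, LinearMap.smul_apply]

protected theorem mul_smul (c : k) (x y : PathAlgebra k W) : x * (c • y) = c • (x * y) := by
  simp only [mul_def, map_smul]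

protected theorem mul_assoc (x y z : PathAlgebra k W) : x * y * z = x * (y * z) := by
  induction x using PathAlgebra.induction with
  | zero => simp only [PathAlgebra.zero_mul]
  | add x x' hx hx' => simp only [PathAlgebra.add_mul, hx, hx']
  | smul r a b p =>
  induction y using PathAlgebra.induction with
  | zero => simp only [PathAlgebra.zero_mul, PathAlgebra.mul_zero]
  | add y y' hy hy' => simp only [PathAlgebra.add_mul, PathAlgebra.mul_add, hy, hy']
  | smul s c d q =>
  induction z using PathAlgebra.induction with
  | zero => simp only [PathAlgebra.mul_zero]
  | add z z' hz hz' => simp only [PathAlgebra.mul_add, hz, hz']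
  | smul t e f u =>
  simp only [PathAlgebra.smul_mul, PathAlgebra.mul_smul]
  congr 3
  by_cases h : b = c
  · subst h
    by_cases h' : d = e
    · subst h'
      simp
    · rw [ofPath_mul_ofPath, ofPath_mul_of_ne _ _ h', ofPath_mul_of_ne _ _ h',
        PathAlgebra.mul_zero]
  · rw [ofPath_mul_of_ne _ _ h, PathAlgebra.zero_mul]
    by_cases h' : d = e
    · subst h'
      rw [ofPath_mul_ofPath, ofPath_mul_of_ne _ _ h]
    · rw [ofPath_mul_of_ne _ _ h', PathAlgebra.mul_zero]

/-- The trivial path `e_a` in the path algebra. -/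
noncomputable def idem (a : W) : PathAlgebra k W := ofPath (Quiver.Path.nil : Quiver.Path a a)

theorem idem_mul_idem (a : W) : (idem a * idem a : PathAlgebra k W) = idem a :=
  ofPath_mul_ofPath _ _

/-- An arrow, as an element of the path algebra. -/
noncomputable def ofArrow {a b : W} (f : a ⟶ b) : PathAlgebra k W := ofPath f.toPath

variable [Fintype W]

/-- The identity of the path algebra of a quiver with finitely many vertices. -/
noncomputable instance : One (PathAlgebra k W) := ⟨∑ a : W, idem a⟩

theorem one_def : (1 : PathAlgebra k W) = ∑ a : W, idem a := rfl

protected theorem one_mul (x : PathAlgebra k W) : 1 * x = x := by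
  induction x using PathAlgebra.induction with
  | zero => exact PathAlgebra.mul_zero _
  | add x y hx hy => rw [PathAlgebra.mul_add, hx, hy]
  | smul r a b p =>
  rw [PathAlgebra.mul_smul, one_def, mul_def, map_sum, LinearMap.sum_apply,
    Finset.sum_eq_single a]
  · rw [← mul_def, idem, ofPath_mul_ofPath, Quiver.Path.nil_comp]
  · intro c _ hc
    rw [← mul_def, idem, ofPath_mul_of_ne _ _ hc]
  · exact fun h => absurd (Finset.mem_univ a) h

protected theorem mul_one (x : PathAlgebra k W) : x * 1 = x := by
  induction x using PathAlgebra.induction with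
  | zero => exact PathAlgebra.zero_mul _
  | add x y hx hy => rw [PathAlgebra.add_mul, hx, hy]
  | smul r a b p =>
  rw [PathAlgebra.smul_mul, one_def, mul_def, map_sum, Finset.sum_eq_single b]
  · rw [← mul_def, idem, ofPath_mul_ofPath, Quiver.Path.comp_nil]
  · intro c _ hc
    rw [← mul_def, idem, ofPath_mul_of_ne _ _ hc.symm]
  · exact fun h => absurd (Finset.mem_univ b) h

noncomputable instance : Ring (PathAlgebra k W) where
  __ := (inferInstance : AddCommGroup (PathAlgebra k W))
  mul := (· * ·)
  one := 1
  left_distrib := PathAlgebra.mul_add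
  right_distrib := PathAlgebra.add_mul
  zero_mul := PathAlgebra.zero_mul
  mul_zero := PathAlgebra.mul_zero
  mul_assoc := PathAlgebra.mul_assoc
  one_mul := PathAlgebra.one_mul
  mul_one := PathAlgebra.mul_one

noncomputable instance : Algebra k (PathAlgebra k W) :=
  Algebra.ofModule PathAlgebra.smul_mul (fun c x y => PathAlgebra.mul_smul c x y)

end

end PathAlgebra

/-! ### Deformed preprojective algebras

The double of a quiver on `V` is Mathlib's `Quiver.Symmetrify V`: its vertices are those of `V`,
and its arrows `a ⟶ b` are the arrows `a ⟶ b` of `V` (ordinary arrows, `Sum.inl`) together with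
one arrow for each arrow `b ⟶ a` of `V` (reverse arrows, `Sum.inr`). -/

namespace DeformedPreprojective

section

variable {k : Type*} {V : Type*} [Field k] [Quiver V]

instance [Fintype V] : Fintype (Quiver.Symmetrify V) := inferInstanceAs (Fintype V)

/-- The ordinary arrow `α` in the path algebra of the double. -/
noncomputable def arrow {a b : V} (f : a ⟶ b) : PathAlgebra k (Quiver.Symmetrify V) :=
  PathAlgebra.ofArrow (W := Quiver.Symmetrify V) (a := a) (b := b) (Sum.inl f)

/-- The reverse arrow of `α` in the path algebra of the double. -/
noncomputable def revArrow {a b : V} (f : a ⟶ b) : PathAlgebra k (Quiver.Symmetrify V) :=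
  PathAlgebra.ofArrow (W := Quiver.Symmetrify V) (a := b) (b := a) (Sum.inr f)

variable [Fintype V] [∀ a b : V, Fintype (a ⟶ b)]

/-- The element `∑_{t(α) = i} α ᾱ - ∑_{h(α) = i} ᾱ α - λ_i e_i`. -/
noncomputable def relation (wt : V → k) (i : V) : PathAlgebra k (Quiver.Symmetrify V) :=
  (∑ j : V, ∑ f : i ⟶ j, arrow f * revArrow f)
    - (∑ j : V, ∑ f : j ⟶ i, revArrow f * arrow f)
    - wt i • PathAlgebra.idem (W := Quiver.Symmetrify V) i

/-- The two-sided ideal generated by the relations at all vertices. -/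
noncomputable def relationIdeal (wt : V → k) :
    TwoSidedIdeal (PathAlgebra k (Quiver.Symmetrify V)) :=
  TwoSidedIdeal.span (Set.range (relation wt))

end

end DeformedPreprojective

/-- The deformed preprojective algebra `Π^λ` of a finite quiver with weight `λ = wt`. -/
def DeformedPreprojective {k V : Type*} [Field k] [Quiver V] [Fintype V]
    [∀ a b : V, Fintype (a ⟶ b)] (wt : V → k) : Type _ :=
  (DeformedPreprojective.relationIdeal wt).ringCon.Quotient

namespace DeformedPreprojective

section

variable {k : Type*} {V : Type*} [Field k] [Quiver V] [Fintype V]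
  [∀ a b : V, Fintype (a ⟶ b)] (wt : V → k)

noncomputable instance : Ring (DeformedPreprojective wt) :=
  inferInstanceAs (Ring (relationIdeal wt).ringCon.Quotient)

noncomputable instance : Algebra k (DeformedPreprojective wt) :=
  inferInstanceAs (Algebra k (relationIdeal wt).ringCon.Quotient)

/-- The quotient map from the path algebra of the double. -/
noncomputable def mk : PathAlgebra k (Quiver.Symmetrify V) →+* DeformedPreprojective wt :=
  (relationIdeal wt).ringCon.mk'

/-- The vertex idempotent `e_i` of `Π^λ`. -/
noncomputable def e (i : V) : DeformedPreprojective wt :=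
  mk wt (PathAlgebra.idem (W := Quiver.Symmetrify V) i)

theorem e_mul_e (i : V) : e wt i * e wt i = e wt i := by
  rw [e, ← map_mul]
  exact congrArg (mk wt) (PathAlgebra.idem_mul_idem _)

theorem isIdempotentElem_e (i : V) : IsIdempotentElem (e wt i) := e_mul_e wt i

/-- The algebra `O^λ = e_o Π^λ e_o`, where `o` is the chosen (extending) vertex. -/
abbrev CornerAlgebra (o : V) : Type _ := (isIdempotentElem_e wt o).Corner

/-- The vertex module `V_i = e_i Π^λ e_o`, as a subgroup of `Π^λ`. -/
def VertexModule (o i : V) : AddSubgroup (DeformedPreprojective wt) where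
  carrier := {x | ∃ r, x = e wt i * r * e wt o}
  zero_mem' := ⟨0, by simp⟩
  add_mem' := by
    rintro _ _ ⟨r, rfl⟩ ⟨s, rfl⟩
    exact ⟨r + s, by rw [mul_add, add_mul]⟩
  neg_mem' := by
    rintro _ ⟨r, rfl⟩
    exact ⟨-r, by rw [mul_neg, neg_mul]⟩

/-- `V_i` is a right `O^λ`-module, by right multiplication in `Π^λ`. -/
noncomputable instance (o i : V) :
    Module (CornerAlgebra wt o)ᵐᵒᵖ (VertexModule wt o i) where
  smul r x := ⟨x.1 * r.unop.1, by
    obtain ⟨s, hs⟩ := x.2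
    obtain ⟨t, ht⟩ := r.unop.2
    refine ⟨s * e wt o * e wt o * t, ?_⟩
    rw [hs, ← ht]
    simp only [mul_assoc]⟩
  one_smul := by
    rintro ⟨_, r, rfl⟩
    refine Subtype.ext ?_
    change e wt i * r * e wt o * e wt o = e wt i * r * e wt o
    rw [mul_assoc, e_mul_e]
  mul_smul r s x := Subtype.ext (mul_assoc x.1 s.unop.1 r.unop.1).symm
  smul_zero r := Subtype.ext (zero_mul r.unop.1)
  smul_add r x y := Subtype.ext (add_mul x.1 y.1 r.unop.1)
  add_smul r s x := Subtype.ext (mul_add x.1 r.unop.1 s.unop.1)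
  zero_smul x := Subtype.ext (mul_zero x.1)

end

end DeformedPreprojective

/-! ### Extended Dynkin quivers -/

/-- The types of extended Dynkin graphs: `Ã_n` for `n ≥ 1`, `D̃_n` for `n ≥ 4`, `Ẽ_6`, `Ẽ_7`,
`Ẽ_8`. -/
inductive ExtendedDynkinType : Type
  | A (n : ℕ) (hn : 1 ≤ n)
  | D (n : ℕ) (hn : 4 ≤ n)
  | E6
  | E7
  | E8

namespace ExtendedDynkinType

/-- The number `n` such that the vertices are `0, …, n`. -/
def rank : ExtendedDynkinType → ℕ
  | A n _ => n
  | D n _ => n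
  | E6 => 6
  | E7 => 7
  | E8 => 8

/-- The pairs `(i, j)` of vertices such that `i — j` is listed as an edge; each edge is listed
in exactly one direction. In type `Ã_1` both `(0, 1)` and `(1, 0)` are listed, so that there is a
double edge. -/
def Edge : ExtendedDynkinType → ℕ → ℕ → Prop
  | A n _, i, j => (i < n ∧ j = i + 1) ∨ (i = n ∧ j = 0)
  | D n _, i, j => (i = 0 ∧ j = 2) ∨ (i = 1 ∧ j = 2) ∨ (2 ≤ i ∧ i + 2 ≤ n ∧ j = i + 1) ∨
      (i + 2 = n ∧ j = n)
  | E6, i, j => (i = 0 ∧ j = 1) ∨ (i = 1 ∧ j = 4) ∨ (i = 2 ∧ j = 3) ∨ (i = 3 ∧ j = 4) ∨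
      (i = 4 ∧ j = 5) ∨ (i = 5 ∧ j = 6)
  | E7, i, j => (i < 6 ∧ j = i + 1) ∨ (i = 7 ∧ j = 3)
  | E8, i, j => (i < 7 ∧ j = i + 1) ∨ (i = 8 ∧ j = 5)

open Classical in
/-- The entry at `(i, j)` of the adjacency matrix: the number of edges between `i` and `j`. -/
noncomputable def adjacency (T : ExtendedDynkinType) (i j : ℕ) : ℕ :=
  (if T.Edge i j then 1 else 0) + (if T.Edge j i then 1 else 0)

end ExtendedDynkinType

/-- `V` is an extended Dynkin quiver (with any orientation of its arrows) with extending vertex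
`o`: its underlying graph is one of the graphs above, and `o` corresponds to the vertex `0`. -/
def IsExtendedDynkin (V : Type*) [Quiver V] [∀ a b : V, Fintype (a ⟶ b)] (o : V) : Prop :=
  ∃ (T : ExtendedDynkinType) (φ : V ≃ Fin (T.rank + 1)), φ o = 0 ∧
    ∀ i j : V, Fintype.card (i ⟶ j) + Fintype.card (j ⟶ i) = T.adjacency (φ i) (φ j)

/-- The edges at a vertex `i`, each with its other end `j`: the arrows `i ⟶ j` and `j ⟶ i`. -/
abbrev EdgeAt {V : Type*} [Quiver V] (i : V) : Type _ :=
  Σ j : V, (i ⟶ j) ⊕ (j ⟶ i)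

/-!
Write `P` for the path algebra of the double of `Q` and `Π` for its quotient by the deformed
relations. The maps of the sequence are left multiplications by arrows of the double:
`g : (x_a)_a ↦ ∑ a x_a`, where `a` runs over the arrows of the double with tail `i`, and
`f : x ↦ (± a* x)_a`, with the signs of the relation at `i`. As `λ_i = 0`, that relation says that
`g ∘ f = 0`. Surjectivity of `g` holds because a path from `i` to `o ≠ i` has a first arrow, and
exactness in the middle because the right ideals `a P` are free with direct sum and the relation at
`i` is the only one that does not start with an arrow (`exists_sub_mem_filteredRel`).

Injectivity of `f` is the substantial part. It is proved for the undeformed relations first, and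
transferred to the deformed ones by a filtration argument.

*Undeformed relations.* Let `δ` be a positive vector with `A δ ≥ 2 δ`, where `A` is the adjacency
matrix; on an extended Dynkin graph the minimal imaginary root is one. Consider the column
`e_i Π⁰ e_o`, graded by the length of paths, and weight dimensions with `δ`. By induction on the
degree, any nonzero family `X` of subspaces of the degree `n` part spans, after multiplication by
all arrows, a family of strictly larger weighted dimension (`Expanding`). Indeed, let `Y` be a
family in degree `n + 1` and `X` the family of all elements of degree `n` that the arrows send into
`Y`. The arrows are jointly injective on degree `n` by the inductive hypothesis, so the family
generated by `Y` in degree `n + 2` has dimension vector `A y - x`, hence weighted dimension at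
least `2 |y| - |x|`, and `|x| < |y|` by the inductive hypothesis again
(`Expanding.succ`). The defect `|y| - |x|` thus never decreases. Expansion clearly excludes an
element killed by all arrows (`Expanding.mem_gradedRel`).

*Deformed relations.* `gradedRel` and `filteredRel` are the columns of the undeformed and the
deformed ideal, described by recursion on the length. If the longest terms of a combination of
deformed relations cancel, joint injectivity for the undeformed relations shows that the
combination can be rewritten with shorter terms (`mem_filteredRel_of_lengthPart_eq_zero`). So the
longest parts of the deformed relations are exactly the undeformed relations, and injectivity
follows by looking at longest parts (`mem_filteredRel_of_forall_mul_mem`).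

Paths from `i` to `o` of length `n - 1` are given the degree `n`; the induction then starts from
the zero space in degree `0`.
-/

namespace PathAlgebra

/-! ### Paths with a fixed end -/

section

variable {k W : Type*} [Field k] [Quiver W]

/-- An arrow with tail `i` as an element of the path algebra. -/
noncomputable def starElt (k : Type*) [Field k] {i : W} (a : Quiver.Star i) : PathAlgebra k W :=
  ofArrow a.2

/-- A path, as an element of the path algebra with explicit coefficients. -/
noncomputable abbrev pathElt (k : Type*) [Field k] {i j : W} (p : Quiver.Path i j) :
    PathAlgebra k W :=
  ofPath p

theorem length_star_comp {i j : W} (a : Quiver.Star i) (q : Quiver.Path a.1 j) :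
    (a.2.toPath.comp q).length = q.length + 1 := by
  rw [Quiver.Path.length_comp, add_comm]
  rfl

theorem starElt_mul_pathElt {i j : W} (a : Quiver.Star i) (q : Quiver.Path a.1 j) :
    starElt k a * pathElt k q = pathElt k (a.2.toPath.comp q) :=
  ofPath_mul_ofPath _ _

theorem toPath_comp_inj {i j c d : W} (f : i ⟶ c) (g : i ⟶ d) (p : Quiver.Path c j)
    (q : Quiver.Path d j) (h : f.toPath.comp p = g.toPath.comp q) :
    (⟨⟨c, f⟩, p⟩ : Σ a : Quiver.Star i, Quiver.Path a.1 j) = ⟨⟨d, g⟩, q⟩ := by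
  revert q
  induction p with
  | nil =>
    intro q h
    cases q with
    | nil =>
      cases h
      rfl
    | cons q e =>
      have := congrArg Quiver.Path.length h
      simp [Quiver.Path.length_comp] at this
  | cons p e ih =>
    intro q h
    cases q with
    | nil =>
      have := congrArg Quiver.Path.length h
      simp [Quiver.Path.length_comp] at this
    | cons q e' =>
      rw [Quiver.Path.comp_cons, Quiver.Path.comp_cons] at h
      have h1 := Quiver.Path.obj_eq_of_cons_eq_cons h
      subst h1
      have h2 := eq_of_heq (Quiver.Path.heq_of_cons_eq_cons h)
      cases eq_of_heq (Quiver.Path.hom_heq_of_cons_eq_cons h)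
      have := ih q h2
      cases this
      rfl

/-- The first arrow of a path, and the rest of the path, are determined by the path. -/
theorem star_comp_inj {i j : W} {a b : Quiver.Star i} {p : Quiver.Path a.1 j}
    {q : Quiver.Path b.1 j} (h : a.2.toPath.comp p = b.2.toPath.comp q) :
    (⟨a, p⟩ : Σ c : Quiver.Star i, Quiver.Path c.1 j) = ⟨b, q⟩ :=
  toPath_comp_inj _ _ _ _ h

variable (k)

/-- The span of the paths from `i` to `o`. -/
noncomputable def column (o i : W) : Submodule k (PathAlgebra k W) :=
  Submodule.span k (Set.range fun p : Quiver.Path i o => pathElt k p)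

/-- The span of the paths from `i` to `o` of length less than `n`. -/
noncomputable def columnBelow (o : W) (n : ℕ) (i : W) : Submodule k (PathAlgebra k W) :=
  Submodule.span k {x | ∃ p : Quiver.Path i o, p.length + 1 ≤ n ∧ pathElt k p = x}

/-- The span of the paths from `i` to `o` of length `n - 1`. The shift makes room for the zero
space, which stands for the paths of length `-1`, as the term of index `0`. -/
noncomputable def columnPiece (o : W) (n : ℕ) (i : W) : Submodule k (PathAlgebra k W) :=
  Submodule.span k {x | ∃ p : Quiver.Path i o, p.length + 1 = n ∧ pathElt k p = x}

open Classical in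
/-- The linear projection of the path algebra onto the span of the paths of length `n - 1`. -/
noncomputable def lengthPart (n : ℕ) : PathAlgebra k W →ₗ[k] PathAlgebra k W :=
  (Finsupp.linearCombination k fun p : QuiverPath W =>
    if p.2.2.length + 1 = n then pathElt k p.2.2 else 0 :
    (QuiverPath W →₀ k) →ₗ[k] PathAlgebra k W)

variable {k}

open Classical in
theorem lengthPart_pathElt (n : ℕ) {i j : W} (p : Quiver.Path i j) :
    lengthPart k n (pathElt k p) =
      if p.length + 1 = n then pathElt k p else 0 := by
  rw [lengthPart, pathElt, ofPath]
  erw [Finsupp.linearCombination_single, one_smul]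
  rfl

variable {o i : W} {n : ℕ}

theorem columnPiece_le_columnBelow : columnPiece k o n i ≤ columnBelow k o n i :=
  Submodule.span_mono fun _ ⟨p, hp, h⟩ => ⟨p, hp.le, h⟩

theorem columnBelow_le_column : columnBelow k o n i ≤ column k o i :=
  Submodule.span_mono fun _ ⟨p, _, h⟩ => ⟨p, h⟩

theorem columnPiece_le_column : columnPiece k o n i ≤ column k o i :=
  columnPiece_le_columnBelow.trans columnBelow_le_column

theorem columnBelow_mono {m : ℕ} (h : m ≤ n) : columnBelow k o m i ≤ columnBelow k o n i :=
  Submodule.span_mono fun _ ⟨p, hp, e⟩ => ⟨p, hp.trans h, e⟩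

theorem columnPiece_zero : columnPiece k o 0 i = ⊥ :=
  Submodule.span_eq_bot.2 fun _ ⟨_, hp, _⟩ => absurd hp (Nat.succ_ne_zero _)

theorem columnBelow_zero : columnBelow k o 0 i = ⊥ :=
  Submodule.span_eq_bot.2 fun _ ⟨_, hp, _⟩ => absurd hp (Nat.not_succ_le_zero _)

theorem exists_mem_columnBelow {x : PathAlgebra k W} (hx : x ∈ column k o i) :
    ∃ n, x ∈ columnBelow k o n i := by
  induction hx using Submodule.span_induction with
  | mem x h =>
    obtain ⟨p, rfl⟩ := h
    exact ⟨_, Submodule.subset_span ⟨p, le_rfl, rfl⟩⟩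
  | zero => exact ⟨0, zero_mem _⟩
  | add x y _ _ hx hy =>
    obtain ⟨m, hm⟩ := hx
    obtain ⟨n, hn⟩ := hy
    exact ⟨max m n, add_mem (columnBelow_mono (le_max_left m n) hm)
      (columnBelow_mono (le_max_right m n) hn)⟩
  | smul c x _ hx =>
    obtain ⟨m, hm⟩ := hx
    exact ⟨m, Submodule.smul_mem _ _ hm⟩

theorem idem_mul_starElt (a : Quiver.Star i) : idem i * starElt k a = starElt k a :=
  (ofPath_mul_ofPath _ _).trans (congrArg ofPath (Quiver.Path.nil_comp _))

variable [Fintype W]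

theorem starElt_mul_mem_column (a : Quiver.Star i) {x : PathAlgebra k W}
    (hx : x ∈ column k o a.1) : starElt k a * x ∈ column k o i := by
  refine Submodule.span_induction (p := fun x _ => starElt k a * x ∈ column k o i)
    ?_ ?_ ?_ ?_ hx
  · rintro _ ⟨p, rfl⟩
    exact Submodule.subset_span ⟨_, (starElt_mul_pathElt a p).symm⟩
  · rw [mul_zero]; exact zero_mem _
  · intro x y _ _ hx hy
    rw [mul_add]; exact add_mem hx hy
  · intro c x _ hx
    rw [mul_smul_comm]; exact Submodule.smul_mem _ _ hx

theorem starElt_mul_mem_columnPiece (a : Quiver.Star i) {x : PathAlgebra k W}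
    (hx : x ∈ columnPiece k o n a.1) : starElt k a * x ∈ columnPiece k o (n + 1) i := by
  refine Submodule.span_induction
    (p := fun x _ => starElt k a * x ∈ columnPiece k o (n + 1) i) ?_ ?_ ?_ ?_ hx
  · rintro _ ⟨p, hp, rfl⟩
    exact Submodule.subset_span
      ⟨_, by rw [length_star_comp, hp], (starElt_mul_pathElt a p).symm⟩
  · rw [mul_zero]; exact zero_mem _
  · intro x y _ _ hx hy
    rw [mul_add]; exact add_mem hx hy
  · intro c x _ hx
    rw [mul_smul_comm]; exact Submodule.smul_mem _ _ hx

theorem starElt_mul_mem_columnBelow (a : Quiver.Star i) {x : PathAlgebra k W}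
    (hx : x ∈ columnBelow k o n a.1) : starElt k a * x ∈ columnBelow k o (n + 1) i := by
  refine Submodule.span_induction
    (p := fun x _ => starElt k a * x ∈ columnBelow k o (n + 1) i) ?_ ?_ ?_ ?_ hx
  · rintro _ ⟨p, hp, rfl⟩
    exact Submodule.subset_span
      ⟨_, by rw [length_star_comp]; lia, (starElt_mul_pathElt a p).symm⟩
  · rw [mul_zero]; exact zero_mem _
  · intro x y _ _ hx hy
    rw [mul_add]; exact add_mem hx hy
  · intro c x _ hx
    rw [mul_smul_comm]; exact Submodule.smul_mem _ _ hx

theorem lengthPart_eq_self {x : PathAlgebra k W} (hx : x ∈ columnPiece k o n i) :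
    lengthPart k n x = x := by
  refine Submodule.span_induction (p := fun x _ => lengthPart k n x = x) ?_ ?_ ?_ ?_ hx
  · rintro _ ⟨p, hp, rfl⟩
    rw [lengthPart_pathElt, if_pos hp]
  · exact map_zero _
  · intro x y _ _ hx hy
    rw [map_add, hx, hy]
  · intro c x _ hx
    rw [map_smul, hx]

theorem lengthPart_eq_zero {m : ℕ} (hmn : m < n) {x : PathAlgebra k W}
    (hx : x ∈ columnBelow k o m i) : lengthPart k n x = 0 := by
  refine Submodule.span_induction (p := fun x _ => lengthPart k n x = 0) ?_ ?_ ?_ ?_ hx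
  · rintro _ ⟨p, hp, rfl⟩
    rw [lengthPart_pathElt, if_neg (by lia)]
  · exact map_zero _
  · intro x y _ _ hx hy
    rw [map_add, hx, hy, add_zero]
  · intro c x _ hx
    rw [map_smul, hx, smul_zero]

theorem lengthPart_mem {x : PathAlgebra k W} (hx : x ∈ column k o i) :
    lengthPart k n x ∈ columnPiece k o n i := by
  refine Submodule.span_induction (p := fun x _ => lengthPart k n x ∈ columnPiece k o n i)
    ?_ ?_ ?_ ?_ hx
  · rintro _ ⟨p, rfl⟩
    dsimp only
    rw [lengthPart_pathElt]
    split_ifs with h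
    · exact Submodule.subset_span ⟨p, h, rfl⟩
    · exact zero_mem _
  · rw [map_zero]; exact zero_mem _
  · intro x y _ _ hx hy
    rw [map_add]; exact add_mem hx hy
  · intro c x _ hx
    rw [map_smul]; exact Submodule.smul_mem _ _ hx

theorem sub_lengthPart_mem {x : PathAlgebra k W} (hx : x ∈ columnBelow k o (n + 1) i) :
    x - lengthPart k (n + 1) x ∈ columnBelow k o n i := by
  refine Submodule.span_induction
    (p := fun x _ => x - lengthPart k (n + 1) x ∈ columnBelow k o n i) ?_ ?_ ?_ ?_ hx
  · rintro _ ⟨p, hp, rfl⟩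
    rw [lengthPart_pathElt]
    split_ifs with h
    · rw [sub_self]; exact zero_mem _
    · rw [sub_zero]; exact Submodule.subset_span ⟨p, by lia, rfl⟩
  · rw [map_zero, sub_zero]; exact zero_mem _
  · intro x y _ _ hx hy
    rw [map_add, add_sub_add_comm]; exact add_mem hx hy
  · intro c x _ hx
    rw [map_smul, ← smul_sub]; exact Submodule.smul_mem _ _ hx

theorem mem_columnBelow_of_lengthPart_eq_zero {x : PathAlgebra k W}
    (hx : x ∈ columnBelow k o (n + 1) i) (h : lengthPart k (n + 1) x = 0) :
    x ∈ columnBelow k o n i := by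
  have := sub_lengthPart_mem hx
  rwa [h, sub_zero] at this

theorem lengthPart_starElt_mul (a : Quiver.Star i) {x : PathAlgebra k W}
    (hx : x ∈ column k o a.1) :
    lengthPart k (n + 1) (starElt k a * x) = starElt k a * lengthPart k n x := by
  refine Submodule.span_induction
    (p := fun x _ => lengthPart k (n + 1) (starElt k a * x) = starElt k a * lengthPart k n x)
    ?_ ?_ ?_ ?_ hx
  · rintro _ ⟨p, rfl⟩
    dsimp only
    rw [starElt_mul_pathElt, lengthPart_pathElt, lengthPart_pathElt, length_star_comp]
    by_cases h : p.length + 1 = n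
    · rw [if_pos h, if_pos (by lia), starElt_mul_pathElt]
    · rw [if_neg h, if_neg (by lia), mul_zero]
  · rw [mul_zero, map_zero, map_zero, mul_zero]
  · intro x y _ _ hx hy
    rw [mul_add, map_add, map_add, mul_add, hx, hy]
  · intro c x _ hx
    rw [mul_smul_comm, map_smul, map_smul, hx, mul_smul_comm]

theorem idem_mul {x : PathAlgebra k W} (hx : x ∈ column k o i) :
    idem i * x = x := by
  refine Submodule.span_induction (p := fun x _ => idem i * x = x) ?_ ?_ ?_ ?_ hx
  · rintro _ ⟨p, rfl⟩
    exact (ofPath_mul_ofPath _ _).trans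
      (congrArg (fun q : Quiver.Path i o => pathElt k q) (Quiver.Path.nil_comp _))
  · exact mul_zero _
  · intro x y _ _ hx hy
    rw [mul_add, hx, hy]
  · intro c x _ hx
    rw [mul_smul_comm, hx]

theorem mul_idem {x : PathAlgebra k W} (hx : x ∈ column k o i) :
    x * idem o = x := by
  refine Submodule.span_induction (p := fun x _ => x * idem o = x) ?_ ?_ ?_ ?_ hx
  · rintro _ ⟨p, rfl⟩
    exact ofPath_mul_ofPath _ _
  · exact zero_mul _
  · intro x y _ _ hx hy
    rw [add_mul, hx, hy]
  · intro c x _ hx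
    rw [smul_mul_assoc, hx]

theorem idem_mul_mul_mem_column (o i : W) (x : PathAlgebra k W) :
    idem i * x * idem o ∈ column k o i := by
  induction x using induction with
  | zero => rw [mul_zero, zero_mul]; exact zero_mem _
  | add x y hx hy => rw [mul_add, add_mul]; exact add_mem hx hy
  | smul c a b p =>
    rw [mul_smul_comm, smul_mul_assoc]
    refine Submodule.smul_mem _ _ ?_
    by_cases hi : i = a
    · subst hi
      by_cases ho : b = o
      · subst ho
        have hp : ofPath p ∈ column k b i := Submodule.subset_span ⟨p, rfl⟩
        rw [idem_mul hp, mul_idem hp]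
        exact hp
      · rw [mul_assoc, idem, idem, ofPath_mul_of_ne p _ ho,
          mul_zero]
        exact zero_mem _
    · rw [idem, ofPath_mul_of_ne _ p hi, zero_mul]
      exact zero_mem _

/-- The coefficient of a path. -/
def coeff (p : QuiverPath W) : PathAlgebra k W →ₗ[k] k :=
  (Finsupp.lapply p : (QuiverPath W →₀ k) →ₗ[k] k)

open Classical in
theorem coeff_pathElt {i j i' j' : W} (p : Quiver.Path i j) (q : Quiver.Path i' j') :
    coeff ⟨i', j', q⟩ (pathElt k p) =
      if (⟨i, j, p⟩ : QuiverPath W) = ⟨i', j', q⟩ then 1 else 0 :=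
  Finsupp.single_apply

theorem eq_zero_of_coeff {x : PathAlgebra k W} (h : ∀ p, coeff p x = 0) : x = 0 :=
  Finsupp.ext h

open Classical in
/-- The coefficient of `x` at a path `q` is the coefficient of `a x` at the path `a q`, and the
coefficient of `b x` at `a q` vanishes for any other arrow `b`. -/
theorem coeff_starElt_mul (a b : Quiver.Star i) (q : Quiver.Path a.1 o) {x : PathAlgebra k W}
    (hx : x ∈ column k o b.1) :
    coeff ⟨i, o, a.2.toPath.comp q⟩ (starElt k b * x) =
      if b = a then coeff ⟨a.1, o, q⟩ x else 0 := by
  refine Submodule.span_induction (p := fun x _ =>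
    coeff ⟨i, o, a.2.toPath.comp q⟩ (starElt k b * x) =
      if b = a then coeff ⟨a.1, o, q⟩ x else 0) ?_ ?_ ?_ ?_ hx
  · rintro _ ⟨p, rfl⟩
    dsimp only
    rw [starElt_mul_pathElt, coeff_pathElt, coeff_pathElt]
    by_cases hb : b = a
    · subst hb
      rw [if_pos rfl]
      refine if_congr ⟨fun e => ?_, fun e => ?_⟩ rfl rfl
      · have e' : b.2.toPath.comp p = b.2.toPath.comp q := by simpa using e
        rw [Quiver.Path.comp_injective_right _ e']
      · have e' : p = q := by simpa using e
        rw [e']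
    · rw [if_neg hb, if_neg]
      intro e
      have e' : b.2.toPath.comp p = a.2.toPath.comp q := by simpa using e
      exact hb (congrArg Sigma.fst (star_comp_inj e'))
  · rw [mul_zero, map_zero, map_zero, ite_self]
  · intro x y _ _ hx hy
    rw [mul_add, map_add, hx, hy, map_add]
    split_ifs <;> simp
  · intro c x _ hx
    rw [mul_smul_comm, map_smul, hx, map_smul]
    split_ifs <;> simp

theorem coeff_eq_zero {x : PathAlgebra k W} (hx : x ∈ column k o i) {p : QuiverPath W}
    (hp : ¬ (p.1 = i ∧ p.2.1 = o)) : coeff p x = 0 := by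
  classical
  refine Submodule.span_induction (p := fun x _ => coeff p x = 0) ?_ ?_ ?_ ?_ hx
  · rintro _ ⟨q, rfl⟩
    obtain ⟨a, b, p⟩ := p
    refine (coeff_pathElt q p).trans (if_neg fun e => hp ?_)
    cases e
    exact ⟨rfl, rfl⟩
  · exact map_zero _
  · intro x y _ _ hx hy
    rw [map_add, hx, hy, add_zero]
  · intro c x _ hx
    rw [map_smul, hx, smul_zero]

variable [∀ a b : W, Fintype (a ⟶ b)]

/-- The right ideals generated by the arrows are free, and their sum is direct. -/
theorem eq_zero_of_sum_starElt_mul_eq_zero {x : Quiver.Star i → PathAlgebra k W}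
    (hx : ∀ a, x a ∈ column k o a.1) (h : ∑ a, starElt k a * x a = 0) (a : Quiver.Star i) :
    x a = 0 := by
  classical
  refine eq_zero_of_coeff fun p => ?_
  by_cases hp : p.1 = a.1 ∧ p.2.1 = o
  · obtain ⟨c, d, q⟩ := p
    obtain ⟨rfl, rfl⟩ : c = a.1 ∧ d = o := hp
    have := congrArg (coeff ⟨i, d, a.2.toPath.comp q⟩) h
    rw [map_sum, map_zero, Finset.sum_congr rfl fun b _ => coeff_starElt_mul a b q (hx b),
      Finset.sum_ite_eq' Finset.univ a] at this
    simpa using this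
  · exact coeff_eq_zero (hx a) hp

theorem exists_eq_sum_of_mem_columnPiece {x : PathAlgebra k W}
    (hx : x ∈ columnPiece k o (n + 2) i) :
    ∃ y : Quiver.Star i → PathAlgebra k W, (∀ a, y a ∈ columnPiece k o (n + 1) a.1) ∧
      ∑ a, starElt k a * y a = x := by
  classical
  induction hx using Submodule.span_induction with
  | mem x h =>
    obtain ⟨p, hp, rfl⟩ := h
    obtain ⟨c, f, q, hq, rfl⟩ := Quiver.Path.eq_toPath_comp_of_length_eq_succ p (n := n) (by lia)
    refine ⟨Pi.single ⟨c, f⟩ (pathElt k q), fun a => ?_, ?_⟩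
    · by_cases ha : a = ⟨c, f⟩
      · subst ha
        rw [Pi.single_eq_same]
        exact Submodule.subset_span ⟨q, by lia, rfl⟩
      · rw [Pi.single_eq_of_ne ha]; exact zero_mem _
    · rw [Finset.sum_eq_single ⟨c, f⟩, Pi.single_eq_same]
      · exact starElt_mul_pathElt ⟨c, f⟩ q
      · intro b _ hb
        rw [Pi.single_eq_of_ne hb, mul_zero]
      · exact fun h => absurd (Finset.mem_univ _) h
  | zero => exact ⟨0, fun _ => zero_mem _, by simp⟩
  | add x x' _ _ hx hx' =>
    obtain ⟨y, hy, rfl⟩ := hx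
    obtain ⟨y', hy', rfl⟩ := hx'
    exact ⟨y + y', fun a => add_mem (hy a) (hy' a), by
      simp [mul_add, Finset.sum_add_distrib]⟩
  | smul c x _ hx =>
    obtain ⟨y, hy, rfl⟩ := hx
    exact ⟨c • y, fun a => Submodule.smul_mem _ _ (hy a), by simp [Finset.smul_sum]⟩

theorem exists_eq_sum_of_ne (hi : i ≠ o) {x : PathAlgebra k W} (hx : x ∈ column k o i) :
    ∃ y : Quiver.Star i → PathAlgebra k W, (∀ a, y a ∈ column k o a.1) ∧
      ∑ a, starElt k a * y a = x := by
  induction hx using Submodule.span_induction with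
  | mem x h =>
    obtain ⟨p, rfl⟩ := h
    obtain ⟨n, hn⟩ : ∃ n, p.length = n + 1 :=
      Nat.exists_eq_succ_of_ne_zero fun h => hi (Quiver.Path.eq_of_length_zero p h)
    obtain ⟨y, hy, h⟩ := exists_eq_sum_of_mem_columnPiece (k := k) (n := n)
      (Submodule.subset_span ⟨p, by lia, rfl⟩)
    exact ⟨y, fun a => columnPiece_le_column (hy a), h⟩
  | zero => exact ⟨0, fun _ => zero_mem _, by simp⟩
  | add x x' _ _ hx hx' =>
    obtain ⟨y, hy, rfl⟩ := hx
    obtain ⟨y', hy', rfl⟩ := hx'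
    exact ⟨y + y', fun a => add_mem (hy a) (hy' a), by
      simp [mul_add, Finset.sum_add_distrib]⟩
  | smul c x _ hx =>
    obtain ⟨y, hy, rfl⟩ := hx
    exact ⟨c • y, fun a => Submodule.smul_mem _ _ (hy a), by simp [Finset.smul_sum]⟩

instance finiteDimensional_columnPiece (o : W) (n : ℕ) (i : W) :
    FiniteDimensional k (columnPiece k o n i) := by
  induction n generalizing i with
  | zero => rw [columnPiece_zero]; infer_instance
  | succ n ih =>
    cases n with
    | zero =>
      have h : columnPiece k o (0 + 1) i ≤ Submodule.span k {idem o} := by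
        refine Submodule.span_le.2 ?_
        rintro _ ⟨p, hp, rfl⟩
        have hp' : p.length = 0 := by lia
        obtain rfl := Quiver.Path.eq_of_length_zero p hp'
        rw [Quiver.Path.eq_nil_of_length_zero p hp']
        exact Submodule.subset_span rfl
      exact Submodule.finiteDimensional_of_le h
    | succ n =>
      have h : columnPiece k o (n + 1 + 1) i ≤ ⨆ a : Quiver.Star i,
          (columnPiece k o (n + 1) a.1).map (LinearMap.mulLeft k (starElt k a)) := by
        intro x hx
        obtain ⟨y, hy, rfl⟩ := exists_eq_sum_of_mem_columnPiece hx
        exact sum_mem fun a _ => Submodule.mem_iSup_of_mem a ⟨y a, hy a, rfl⟩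
      exact Submodule.finiteDimensional_of_le h

end

/-! ### Mesh relations -/

section

variable {k W : Type*} [Field k] [Quiver W] [Quiver.HasReverse W] [Fintype W]

/-- The reverse of an arrow with tail `i`. -/
def revStar {i : W} (a : Quiver.Star i) : Quiver.Star a.1 := ⟨i, Quiver.reverse a.2⟩

variable (σ : ∀ i : W, Quiver.Star i → k) (wt : W → k) {o i : W} {n : ℕ}

theorem smul_rev_mul_mem_column (a : Quiver.Star i) {x : PathAlgebra k W}
    (hx : x ∈ column k o i) : σ i a • (starElt k (revStar a) * x) ∈ column k o a.1 :=
  Submodule.smul_mem _ _ (starElt_mul_mem_column (revStar a) hx)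

variable (k) in
/-- The elements of degree `n` at the vertex `i` whose products with all arrows with head `i`
belong to `Y`. -/
noncomputable def meshKernel (o : W) (n : ℕ) (Y : W → Submodule k (PathAlgebra k W)) (i : W) :
    Submodule k (PathAlgebra k W) :=
  columnPiece k o n i ⊓
    ⨅ a : Quiver.Star i, (Y a.1).comap (LinearMap.mulLeft k (starElt k (revStar a)))

theorem mem_meshKernel {Y : W → Submodule k (PathAlgebra k W)} {x : PathAlgebra k W} :
    x ∈ meshKernel k o n Y i ↔
      x ∈ columnPiece k o n i ∧ ∀ a : Quiver.Star i, starElt k (revStar a) * x ∈ Y a.1 := by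
  simp [meshKernel, Submodule.mem_iInf]

variable [∀ a b : W, Fintype (a ⟶ b)]

/-- The mesh relation `∑ σ(a) a a* - λ_i e_i` at the vertex `i`, where `a` runs over the arrows
with tail `i` and `a*` is the reverse of `a`. -/
noncomputable def mesh (i : W) : PathAlgebra k W :=
  ∑ a : Quiver.Star i, σ i a • (starElt k a * starElt k (revStar a)) - wt i • idem i

theorem mesh_mul {x : PathAlgebra k W} (hx : x ∈ column k o i) :
    mesh σ wt i * x =
      ∑ a : Quiver.Star i, starElt k a * (σ i a • (starElt k (revStar a) * x)) - wt i • x := by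
  rw [mesh, sub_mul, Finset.sum_mul, smul_mul_assoc, idem_mul hx]
  congr 1
  refine Finset.sum_congr rfl fun a _ => ?_
  rw [smul_mul_assoc, mul_assoc, mul_smul_comm]

theorem mesh_zero_mul {x : PathAlgebra k W} (hx : x ∈ column k o i) :
    mesh σ 0 i * x =
      ∑ a : Quiver.Star i, starElt k a * (σ i a • (starElt k (revStar a) * x)) := by
  rw [mesh_mul σ 0 hx, Pi.zero_apply, zero_smul, sub_zero]

/-- The map `((u_a)_a, x) ↦ ∑ a u_a + r_i x`, where `r_i` is the mesh relation at `i`. -/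
noncomputable def meshMap (Y X : W → Submodule k (PathAlgebra k W)) (i : W) :
    ((∀ a : Quiver.Star i, Y a.1) × X i) →ₗ[k] PathAlgebra k W :=
  LinearMap.coprod
    (∑ a : Quiver.Star i,
      (LinearMap.mulLeft k (starElt k a) ∘ₗ (Y a.1).subtype) ∘ₗ LinearMap.proj a)
    (LinearMap.mulLeft k (mesh σ wt i) ∘ₗ (X i).subtype)

theorem meshMap_apply (Y X : W → Submodule k (PathAlgebra k W)) (i : W)
    (u : ∀ a : Quiver.Star i, Y a.1) (x : X i) :
    meshMap σ wt Y X i (u, x) =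
      ∑ a : Quiver.Star i, starElt k a * (u a : PathAlgebra k W) + mesh σ wt i * x := by
  simp [meshMap, LinearMap.sum_apply]

/-- The space of all `∑ a u_a + r_i x` with `u_a` in `Y` and `x` in `X`. -/
noncomputable def meshSpan (Y X : W → Submodule k (PathAlgebra k W)) (i : W) :
    Submodule k (PathAlgebra k W) :=
  LinearMap.range (meshMap σ wt Y X i)

variable {σ wt}

theorem mem_meshSpan {Y X : W → Submodule k (PathAlgebra k W)} {z : PathAlgebra k W} :
    z ∈ meshSpan σ wt Y X i ↔ ∃ u : Quiver.Star i → PathAlgebra k W, (∀ a, u a ∈ Y a.1) ∧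
      ∃ x ∈ X i, z = ∑ a : Quiver.Star i, starElt k a * u a + mesh σ wt i * x := by
  constructor
  · rintro ⟨⟨u, x⟩, rfl⟩
    exact ⟨fun a => u a, fun a => (u a).2, x, x.2, meshMap_apply ..⟩
  · rintro ⟨u, hu, x, hx, rfl⟩
    exact ⟨(fun a => ⟨u a, hu a⟩, ⟨x, hx⟩), meshMap_apply ..⟩

theorem starElt_mul_mem_meshSpan {Y X : W → Submodule k (PathAlgebra k W)}
    (a : Quiver.Star i) {u : PathAlgebra k W} (hu : u ∈ Y a.1) :
    starElt k a * u ∈ meshSpan σ wt Y X i := by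
  classical
  refine mem_meshSpan.2 ⟨Pi.single a u, fun b => ?_, 0, zero_mem _, ?_⟩
  · by_cases hb : b = a
    · subst hb; rwa [Pi.single_eq_same]
    · rw [Pi.single_eq_of_ne hb]; exact zero_mem _
  · rw [mul_zero, add_zero, Finset.sum_eq_single a, Pi.single_eq_same]
    · intro b _ hb
      rw [Pi.single_eq_of_ne hb, mul_zero]
    · exact fun h => absurd (Finset.mem_univ _) h

theorem mesh_mul_mem_meshSpan {Y X : W → Submodule k (PathAlgebra k W)} {x : PathAlgebra k W}
    (hx : x ∈ X i) : mesh σ wt i * x ∈ meshSpan σ wt Y X i :=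
  mem_meshSpan.2 ⟨0, fun _ => zero_mem _, x, hx, by simp⟩

theorem meshSpan_mono {Y Y' X X' : W → Submodule k (PathAlgebra k W)}
    (hY : ∀ j, Y j ≤ Y' j) (hX : X i ≤ X' i) :
    meshSpan σ wt Y X i ≤ meshSpan σ wt Y' X' i := by
  intro z hz
  obtain ⟨u, hu, x, hx, rfl⟩ := mem_meshSpan.1 hz
  exact mem_meshSpan.2 ⟨u, fun a => hY _ (hu a), x, hX hx, rfl⟩

variable (σ) in
/-- The part of degree `n` (with the shift of `columnPiece`) of the column `o` of the ideal
generated by the undeformed mesh relations. -/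
noncomputable def gradedRel (o : W) : ℕ → W → Submodule k (PathAlgebra k W)
  | 0 => fun _ => ⊥
  | 1 => fun _ => ⊥
  | n + 2 => meshSpan σ 0 (gradedRel o (n + 1)) (columnPiece k o n)

variable (σ wt) in
/-- The elements of the column `o` of the ideal generated by the deformed mesh relations that can
be written as a sum of products `p r q`, where `r` is a mesh relation and `p`, `q` are paths, in
such a way that no cancellation of terms of length at least `n` occurs. -/
noncomputable def filteredRel (o : W) : ℕ → W → Submodule k (PathAlgebra k W)
  | 0 => fun _ => ⊥
  | 1 => fun _ => ⊥
  | n + 2 => meshSpan σ wt (filteredRel o (n + 1)) (columnBelow k o n)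

theorem starElt_mul_mem_gradedRel (a : Quiver.Star i) {u : PathAlgebra k W}
    (hu : u ∈ gradedRel σ o n a.1) : starElt k a * u ∈ gradedRel σ o (n + 1) i := by
  cases n with
  | zero =>
    rw [gradedRel, Submodule.mem_bot] at hu
    rw [hu, mul_zero]
    exact zero_mem _
  | succ n => exact starElt_mul_mem_meshSpan a hu

theorem starElt_mul_mem_filteredRel (a : Quiver.Star i) {u : PathAlgebra k W}
    (hu : u ∈ filteredRel σ wt o n a.1) :
    starElt k a * u ∈ filteredRel σ wt o (n + 1) i := by
  cases n with
  | zero =>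
    rw [filteredRel, Submodule.mem_bot] at hu
    rw [hu, mul_zero]
    exact zero_mem _
  | succ n => exact starElt_mul_mem_meshSpan a hu

theorem gradedRel_le_columnPiece : gradedRel σ o n i ≤ columnPiece k o n i := by
  induction n using Nat.twoStepInduction generalizing i with
  | zero => exact bot_le
  | one => exact bot_le
  | more n _ ih =>
    intro z hz
    obtain ⟨u, hu, x, hx, rfl⟩ := mem_meshSpan.1 hz
    rw [mesh_zero_mul σ (columnPiece_le_column hx)]
    exact add_mem (sum_mem fun a _ => starElt_mul_mem_columnPiece a (ih (hu a)))
      (sum_mem fun a _ => starElt_mul_mem_columnPiece a (Submodule.smul_mem _ _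
        (starElt_mul_mem_columnPiece (revStar a) hx)))

theorem filteredRel_le_columnBelow : filteredRel σ wt o n i ≤ columnBelow k o n i := by
  induction n using Nat.twoStepInduction generalizing i with
  | zero => exact bot_le
  | one => exact bot_le
  | more n _ ih =>
    intro z hz
    obtain ⟨u, hu, x, hx, rfl⟩ := mem_meshSpan.1 hz
    rw [mesh_mul σ wt (columnBelow_le_column hx)]
    exact add_mem (sum_mem fun a _ => starElt_mul_mem_columnBelow a (ih (hu a)))
      (sub_mem (sum_mem fun a _ => starElt_mul_mem_columnBelow a (Submodule.smul_mem _ _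
        (starElt_mul_mem_columnBelow (revStar a) hx)))
        (Submodule.smul_mem _ _ (columnBelow_mono (by lia) hx)))

theorem filteredRel_le_succ : filteredRel σ wt o n i ≤ filteredRel σ wt o (n + 1) i := by
  induction n using Nat.twoStepInduction generalizing i with
  | zero => exact bot_le
  | one => exact bot_le
  | more n _ ih => exact meshSpan_mono (fun _ => ih) (columnBelow_mono (Nat.le_succ n))

theorem filteredRel_mono {m : ℕ} (h : m ≤ n) : filteredRel σ wt o m i ≤ filteredRel σ wt o n i :=
  monotone_nat_of_le_succ (f := fun n => filteredRel σ wt o n i) (fun _ => filteredRel_le_succ) h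

/-- The longest parts of the deformed relations of length less than `n` are exactly the undeformed
relations of length `n - 1`. -/
theorem lengthPart_mem_gradedRel {z : PathAlgebra k W} (hz : z ∈ filteredRel σ wt o n i) :
    lengthPart k n z ∈ gradedRel σ o n i := by
  induction n using Nat.twoStepInduction generalizing i z with
  | zero =>
    rw [filteredRel, Submodule.mem_bot] at hz
    rw [hz, map_zero]; exact zero_mem _
  | one =>
    rw [filteredRel, Submodule.mem_bot] at hz
    rw [hz, map_zero]; exact zero_mem _
  | more n _ ih =>
    obtain ⟨u, hu, x, hx, rfl⟩ := mem_meshSpan.1 hz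
    have hu' := fun a => columnBelow_le_column (filteredRel_le_columnBelow (hu a))
    have hx' := columnBelow_le_column hx
    refine mem_meshSpan.2 ⟨fun a => lengthPart k (n + 1) (u a), fun a => ih (hu a),
      lengthPart k n x, lengthPart_mem hx', ?_⟩
    rw [mesh_mul σ wt hx', mesh_zero_mul σ (columnPiece_le_column (lengthPart_mem hx')),
      map_add, map_sub, map_smul, lengthPart_eq_zero (by lia) hx, smul_zero, sub_zero, map_sum,
      map_sum]
    congr 1
    · exact Finset.sum_congr rfl fun a _ => lengthPart_starElt_mul a (hu' a)
    · refine Finset.sum_congr rfl fun a _ => ?_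
      rw [lengthPart_starElt_mul a (smul_rev_mul_mem_column σ a hx'), map_smul,
        lengthPart_starElt_mul (revStar a) hx']

theorem exists_lengthPart_eq {r : PathAlgebra k W} (hr : r ∈ gradedRel σ o n i) (wt : W → k) :
    ∃ z ∈ filteredRel σ wt o n i, lengthPart k n z = r := by
  induction n using Nat.twoStepInduction generalizing i r with
  | zero =>
    rw [gradedRel, Submodule.mem_bot] at hr
    exact ⟨0, zero_mem _, by rw [hr, map_zero]⟩
  | one =>
    rw [gradedRel, Submodule.mem_bot] at hr
    exact ⟨0, zero_mem _, by rw [hr, map_zero]⟩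
  | more n _ ih =>
    obtain ⟨u, hu, x, hx, rfl⟩ := mem_meshSpan.1 hr
    choose v hv hvu using fun a => ih (hu a)
    have hx' := columnPiece_le_column hx
    refine ⟨_, mem_meshSpan.2 ⟨v, hv, x, columnPiece_le_columnBelow hx, rfl⟩, ?_⟩
    rw [mesh_mul σ wt hx', mesh_zero_mul σ hx', map_add, map_sub, map_smul,
      lengthPart_eq_zero (by lia) (columnPiece_le_columnBelow hx), smul_zero, sub_zero, map_sum,
      map_sum]
    congr 1
    · refine Finset.sum_congr rfl fun a _ => ?_
      rw [lengthPart_starElt_mul a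
        (columnBelow_le_column (filteredRel_le_columnBelow (hv a))), hvu]
    · refine Finset.sum_congr rfl fun a _ => lengthPart_eq_self (o := o) (i := i) ?_
      exact starElt_mul_mem_columnPiece a (Submodule.smul_mem _ _
        (starElt_mul_mem_columnPiece (revStar a) hx))

/-! ### Injectivity for the undeformed relations -/

theorem finrank_meshSpan_add_finrank_meshKernel (hσ : ∀ i a, σ i a ≠ 0)
    {Y : W → Submodule k (PathAlgebra k W)} (hY : ∀ j, Y j ≤ columnPiece k o (n + 1) j) (i : W) :
    Module.finrank k (meshSpan σ 0 Y (columnPiece k o n) i) +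
        Module.finrank k (meshKernel k o n Y i) =
      ∑ a : Quiver.Star i, Module.finrank k (Y a.1) +
        Module.finrank k (columnPiece k o n i) := by
  have : ∀ j, FiniteDimensional k (Y j) := fun j => Submodule.finiteDimensional_of_le (hY j)
  let Φ := meshMap σ 0 Y (columnPiece k o n) i
  -- `∑ a u_a + r_i x = 0` forces `u_a = - σ(a) a* x`, since the right ideals `a P` are
  -- independent; so the kernel of `Φ` is parametrized by `x`.
  have hker : ∀ p, p ∈ LinearMap.ker Φ ↔
      ∀ a, (p.1 a : PathAlgebra k W) + σ i a • (starElt k (revStar a) * (p.2 : PathAlgebra k W))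
        = 0 := by
    rintro ⟨u, x⟩
    rw [LinearMap.mem_ker, meshMap_apply, mesh_zero_mul σ (columnPiece_le_column x.2),
      ← Finset.sum_add_distrib]
    simp only [← mul_add]
    refine ⟨fun h => eq_zero_of_sum_starElt_mul_eq_zero (o := o) (fun a => ?_) h, fun h => ?_⟩
    · exact add_mem (columnPiece_le_column (hY _ (u a).2))
        (smul_rev_mul_mem_column σ a (columnPiece_le_column x.2))
    · exact Finset.sum_eq_zero fun a _ => by rw [h a, mul_zero]
  let Ψ : LinearMap.ker Φ →ₗ[k] meshKernel k o n Y i :=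
    LinearMap.codRestrict _
      ((columnPiece k o n i).subtype ∘ₗ LinearMap.snd k _ _ ∘ₗ (LinearMap.ker Φ).subtype) (by
      rintro ⟨p, hp⟩
      refine mem_meshKernel.2 ⟨p.2.2, fun a => ?_⟩
      have h := (hker p).1 hp a
      have h' : σ i a • (starElt k (revStar a) * (p.2 : PathAlgebra k W)) ∈ Y a.1 := by
        rw [eq_neg_of_add_eq_zero_right h]
        exact neg_mem (p.1 a).2
      exact (Submodule.smul_mem_iff _ (hσ i a)).1 h')
  have hΨ : Function.Bijective Ψ := by
    constructor
    · rw [← LinearMap.ker_eq_bot, LinearMap.ker_eq_bot']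
      rintro ⟨⟨u, x⟩, hp⟩ h
      have hx : x = 0 := Subtype.ext (congrArg (Submodule.subtype _) h)
      subst hx
      have hu : u = 0 := by
        funext a
        have := (hker _).1 hp a
        simpa using this
      subst hu
      rfl
    · rintro ⟨x, hx⟩
      obtain ⟨hx1, hx2⟩ := mem_meshKernel.1 hx
      refine ⟨⟨(fun a => ⟨-(σ i a • (starElt k (revStar a) * x)),
        neg_mem (Submodule.smul_mem _ _ (hx2 a))⟩, ⟨x, hx1⟩), (hker _).2 fun a => ?_⟩, rfl⟩
      exact neg_add_cancel _
  have h := LinearMap.finrank_range_add_finrank_ker Φ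
  rw [(LinearEquiv.ofBijective Ψ hΨ).finrank_eq, Module.finrank_prod,
    Module.finrank_pi_fintype] at h
  exact h

end

section

variable {k W : Type*} [Field k] [Quiver W] [Fintype W] [∀ a b : W, Fintype (a ⟶ b)]

/-- Summation over all arrows is invariant under reversal of the arrows. -/
theorem sum_mul_sum_star_comm [Quiver.HasInvolutiveReverse W] (δ d : W → ℤ) :
    ∑ i, δ i * ∑ a : Quiver.Star i, d a.1 = ∑ i, d i * ∑ a : Quiver.Star i, δ a.1 := by
  simp only [Finset.mul_sum]
  rw [← Fintype.sum_sigma' fun i (a : Quiver.Star i) => δ i * d a.1,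
    ← Fintype.sum_sigma' fun i (a : Quiver.Star i) => d i * δ a.1]
  have hinv : Function.Involutive
      (fun x : Σ i : W, Quiver.Star i => (⟨x.2.1, revStar x.2⟩ : Σ i : W, Quiver.Star i)) := by
    rintro ⟨i, j, f⟩
    simp [revStar]
  refine Fintype.sum_equiv hinv.toPerm _ _ ?_
  rintro ⟨i, j, f⟩
  exact mul_comm _ _

variable [Quiver.HasInvolutiveReverse W] {σ : ∀ i : W, Quiver.Star i → k} {wt : W → k}
  {o i : W} {n : ℕ} {δ : W → ℤ}

variable (σ) in
/-- The dimension of a space `X` of paths of degree `n` modulo the relations. -/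
noncomputable def relDim (o : W) (n : ℕ) (X : W → Submodule k (PathAlgebra k W)) (i : W) : ℤ :=
  Module.finrank k (X i) - Module.finrank k (gradedRel σ o n i)

variable (σ) in
/-- The arrows enlarge the total dimension of every nonzero family of subspaces of the column
`o` of the undeformed algebra in degree `n`, if dimensions are weighted with `δ`. Subspaces of the
quotient by the relations are given by their preimages `X`, and `Y` is any family of subspaces in
the next degree that contains the products of the arrows with `X`. -/
def Expanding (o : W) (δ : W → ℤ) (n : ℕ) : Prop :=
  ∀ X Y : W → Submodule k (PathAlgebra k W),
    (∀ i, gradedRel σ o n i ≤ X i) → (∀ i, X i ≤ columnPiece k o n i) →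
    (∀ i, gradedRel σ o (n + 1) i ≤ Y i) → (∀ i, Y i ≤ columnPiece k o (n + 1) i) →
    (∀ i, ∀ a : Quiver.Star i, ∀ x ∈ X i, starElt k (revStar a) * x ∈ Y a.1) →
    X ≠ gradedRel σ o n →
    ∑ i, δ i * relDim σ o n X i < ∑ i, δ i * relDim σ o (n + 1) Y i

theorem relDim_nonneg {X : W → Submodule k (PathAlgebra k W)}
    (h : gradedRel σ o n i ≤ X i) (h' : X i ≤ columnPiece k o n i) : 0 ≤ relDim σ o n X i := by
  have : FiniteDimensional k (X i) := Submodule.finiteDimensional_of_le h'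
  exact sub_nonneg.2 (by exact_mod_cast Submodule.finrank_mono h)

theorem relDim_gradedRel : relDim σ o n (gradedRel σ o n) i = 0 := sub_self _

theorem sum_relDim_nonneg (hδ : ∀ i, 0 < δ i) {X : W → Submodule k (PathAlgebra k W)}
    (h : ∀ i, gradedRel σ o n i ≤ X i) (h' : ∀ i, X i ≤ columnPiece k o n i) :
    0 ≤ ∑ i, δ i * relDim σ o n X i :=
  Finset.sum_nonneg fun i _ => mul_nonneg (hδ i).le (relDim_nonneg (h i) (h' i))

theorem sum_relDim_pos (hδ : ∀ i, 0 < δ i) {X : W → Submodule k (PathAlgebra k W)}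
    (h : ∀ i, gradedRel σ o n i ≤ X i) (h' : ∀ i, X i ≤ columnPiece k o n i)
    (hX : X ≠ gradedRel σ o n) : 0 < ∑ i, δ i * relDim σ o n X i := by
  obtain ⟨i, hi⟩ := Function.ne_iff.1 hX
  have : FiniteDimensional k (X i) := Submodule.finiteDimensional_of_le (h' i)
  refine Finset.sum_pos' (fun i _ => mul_nonneg (hδ i).le (relDim_nonneg (h i) (h' i)))
    ⟨i, Finset.mem_univ i, mul_pos (hδ i) (sub_pos.2 ?_)⟩
  exact_mod_cast Submodule.finrank_lt_finrank_of_lt (lt_of_le_of_ne (h i) hi.symm)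

/-- Expansion in degree `n` makes the joint kernel of the arrows trivial in degree `n`: the line
spanned by an element of the kernel would be mapped to `0`. -/
theorem Expanding.mem_gradedRel (H : Expanding σ o δ n) (hδ : ∀ i, 0 < δ i)
    {x : PathAlgebra k W} (hx : x ∈ columnPiece k o n i)
    (h : ∀ a : Quiver.Star i, starElt k (revStar a) * x ∈ gradedRel σ o (n + 1) a.1) :
    x ∈ gradedRel σ o n i := by
  classical
  by_contra hxR
  let X : W → Submodule k (PathAlgebra k W) :=
    Function.update (gradedRel σ o n) i (gradedRel σ o n i ⊔ Submodule.span k {x})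
  have hXi : X i = gradedRel σ o n i ⊔ Submodule.span k {x} := Function.update_self ..
  have hXj : ∀ j, j ≠ i → X j = gradedRel σ o n j := fun j hj => Function.update_of_ne hj ..
  have h1 : ∀ j, gradedRel σ o n j ≤ X j := by
    intro j
    by_cases hj : j = i
    · subst hj; rw [hXi]; exact le_sup_left
    · rw [hXj j hj]
  have h2 : ∀ j, X j ≤ columnPiece k o n j := by
    intro j
    by_cases hj : j = i
    · subst hj; rw [hXi]
      exact sup_le gradedRel_le_columnPiece (Submodule.span_le.2 (Set.singleton_subset_iff.2 hx))
    · rw [hXj j hj]; exact gradedRel_le_columnPiece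
  have h3 : ∀ j, ∀ a : Quiver.Star j, ∀ y ∈ X j,
      starElt k (revStar a) * y ∈ gradedRel σ o (n + 1) a.1 := by
    intro j a y hy
    by_cases hj : j = i
    · subst hj
      rw [hXi] at hy
      obtain ⟨r, hr, s, hs, rfl⟩ := Submodule.mem_sup.1 hy
      obtain ⟨c, rfl⟩ := Submodule.mem_span_singleton.1 hs
      rw [mul_add, mul_smul_comm]
      exact add_mem (starElt_mul_mem_gradedRel _ hr) (Submodule.smul_mem _ _ (h a))
    · rw [hXj j hj] at hy
      exact starElt_mul_mem_gradedRel (revStar a) hy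
  have h4 : X ≠ gradedRel σ o n := by
    intro e
    refine hxR (e ▸ ?_)
    rw [hXi]
    exact Submodule.mem_sup_right (Submodule.mem_span_singleton_self x)
  have h5 := H X (gradedRel σ o (n + 1)) h1 h2 (fun _ => le_rfl)
    (fun _ => gradedRel_le_columnPiece) h3 h4
  simp only [relDim_gradedRel, mul_zero, Finset.sum_const_zero] at h5
  exact absurd (sum_relDim_nonneg hδ h1 h2) (not_le.2 h5)

theorem expanding_zero : Expanding σ o δ 0 := by
  intro X Y _ h2 _ _ _ hX
  refine absurd (funext fun i => ?_) hX
  have := h2 i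
  rw [columnPiece_zero, le_bot_iff] at this
  exact this

/-- If `X` consists of the elements mapped to `Y` by all arrows, then the space in degree `n + 2`
generated by `Y` has dimension vector `A y - x`, where `x` and `y` are the dimension vectors of
`X` and `Y` and `A` is the adjacency matrix. As `A δ ≥ 2 δ`, the weighted dimension grows at least
as much from `Y` on as it does from `X` to `Y`. -/
theorem Expanding.succ (H : Expanding σ o δ n) (hσ : ∀ i a, σ i a ≠ 0) (hδ : ∀ i, 0 < δ i)
    (hA : ∀ i, 2 * δ i ≤ ∑ a : Quiver.Star i, δ a.1) : Expanding σ o δ (n + 1) := by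
  intro Y Z hY hY' hZ hZ' hYZ hne
  let X := meshKernel k o n Y
  have hX : ∀ i, gradedRel σ o n i ≤ X i := fun i x hx =>
    mem_meshKernel.2 ⟨gradedRel_le_columnPiece hx,
      fun a => hY _ (starElt_mul_mem_gradedRel (revStar a) hx)⟩
  have hX' : ∀ i, X i ≤ columnPiece k o n i := fun i x hx => (mem_meshKernel.1 hx).1
  have hker : ∀ i, meshKernel k o n (gradedRel σ o (n + 1)) i = gradedRel σ o n i := by
    intro i
    refine le_antisymm (fun x hx => ?_) (fun x hx => ?_)
    · obtain ⟨h1, h2⟩ := mem_meshKernel.1 hx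
      exact H.mem_gradedRel hδ h1 h2
    · exact mem_meshKernel.2 ⟨gradedRel_le_columnPiece hx,
        fun a => starElt_mul_mem_gradedRel (revStar a) hx⟩
  have hdim : ∀ i, ∑ a : Quiver.Star i, relDim σ o (n + 1) Y a.1 - relDim σ o n X i ≤
      relDim σ o (n + 2) Z i := by
    intro i
    have e1 := finrank_meshSpan_add_finrank_meshKernel hσ hY' i
    have e2 := finrank_meshSpan_add_finrank_meshKernel hσ
      (fun j => gradedRel_le_columnPiece (σ := σ) (o := o) (n := n + 1) (i := j)) i
    rw [hker] at e2
    have : FiniteDimensional k (Z i) := Submodule.finiteDimensional_of_le (hZ' i)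
    have hle : meshSpan σ 0 Y (columnPiece k o n) i ≤ Z i := by
      intro z hz
      obtain ⟨u, hu, x, hx, rfl⟩ := mem_meshSpan.1 hz
      refine add_mem (sum_mem fun a _ => ?_) (hZ i (mesh_mul_mem_meshSpan hx))
      have ha := hYZ a.1 (revStar a) (u a) (hu a)
      have hrev : revStar (revStar a) = a := by simp [revStar]
      rwa [hrev] at ha
    have e3 := Submodule.finrank_mono hle
    have e4 : Module.finrank k (gradedRel σ o (n + 2) i) =
      Module.finrank k (meshSpan σ 0 (gradedRel σ o (n + 1)) (columnPiece k o n) i) := rfl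
    simp only [relDim, Finset.sum_sub_distrib]
    rw [e4]
    zify at e1 e2 e3
    change _ - ((Module.finrank k (meshKernel k o n Y i) : ℤ) - _) ≤ _
    linarith
  have hsum : ∑ i, δ i * (∑ a : Quiver.Star i, relDim σ o (n + 1) Y a.1 - relDim σ o n X i) ≤
      ∑ i, δ i * relDim σ o (n + 2) Z i :=
    Finset.sum_le_sum fun i _ => mul_le_mul_of_nonneg_left (hdim i) (hδ i).le
  simp only [mul_sub, Finset.sum_sub_distrib] at hsum
  rw [sum_mul_sum_star_comm] at hsum
  have htwo : ∑ i, 2 * (δ i * relDim σ o (n + 1) Y i) ≤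
      ∑ i, relDim σ o (n + 1) Y i * ∑ a : Quiver.Star i, δ a.1 := by
    refine Finset.sum_le_sum fun i _ => ?_
    have := mul_le_mul_of_nonneg_left (hA i) (relDim_nonneg (hY i) (hY' i))
    linarith
  rw [← Finset.mul_sum] at htwo
  have hlt : ∑ i, δ i * relDim σ o n X i < ∑ i, δ i * relDim σ o (n + 1) Y i := by
    by_cases hXR : X = gradedRel σ o n
    · rw [hXR]
      simp only [relDim_gradedRel, mul_zero, Finset.sum_const_zero]
      exact sum_relDim_pos hδ hY hY' hne
    · exact H X Y hX hX' hY hY' (fun i a x hx => (mem_meshKernel.1 hx).2 a) hXR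
  linarith

theorem expanding (hσ : ∀ i a, σ i a ≠ 0) (hδ : ∀ i, 0 < δ i)
    (hA : ∀ i, 2 * δ i ≤ ∑ a : Quiver.Star i, δ a.1) (n : ℕ) : Expanding σ o δ n := by
  induction n with
  | zero => exact expanding_zero
  | succ n ih => exact ih.succ hσ hδ hA

/-! ### The deformed relations -/

/-- No new relations of smaller length arise from cancellation of the longest terms. -/
theorem mem_filteredRel_of_lengthPart_eq_zero (hσ : ∀ i a, σ i a ≠ 0)
    (H : ∀ n, Expanding σ o δ n) (hδ : ∀ i, 0 < δ i) {z : PathAlgebra k W}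
    (hz : z ∈ filteredRel σ wt o (n + 1) i) (h : lengthPart k (n + 1) z = 0) :
    z ∈ filteredRel σ wt o n i := by
  induction n generalizing i z with
  | zero => exact hz
  | succ n ih =>
    obtain ⟨u, hu, x, hx, rfl⟩ := mem_meshSpan.1 hz
    have huc := fun a => columnBelow_le_column (filteredRel_le_columnBelow (hu a))
    have hxc := columnBelow_le_column hx
    -- The longest terms of `u a` and of `σ(a) a* x` cancel for each arrow `a` separately.
    have htop : ∀ a : Quiver.Star i, lengthPart k (n + 1) (u a) +
        σ i a • (starElt k (revStar a) * lengthPart k n x) = 0 := by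
      have hx0 : lengthPart k n x ∈ column k o i :=
        columnPiece_le_column (lengthPart_mem (n := n) hxc)
      refine eq_zero_of_sum_starElt_mul_eq_zero (o := o) (fun a => add_mem
        (columnPiece_le_column (lengthPart_mem (huc a))) (smul_rev_mul_mem_column σ a hx0)) ?_
      rw [mesh_mul σ wt hxc, map_add, map_sub, map_smul, lengthPart_eq_zero (by lia) hx,
        smul_zero, sub_zero, map_sum, map_sum, ← Finset.sum_add_distrib] at h
      rw [← h]
      refine Finset.sum_congr rfl fun a _ => ?_
      rw [lengthPart_starElt_mul a (huc a),
        lengthPart_starElt_mul a (smul_rev_mul_mem_column σ a hxc), map_smul,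
        lengthPart_starElt_mul (revStar a) hxc, mul_add]
    have hxR : lengthPart k n x ∈ gradedRel σ o n i := by
      refine (H n).mem_gradedRel hδ (lengthPart_mem hxc) fun a => ?_
      rw [← Submodule.smul_mem_iff _ (hσ i a), eq_neg_of_add_eq_zero_right (htop a)]
      exact neg_mem (lengthPart_mem_gradedRel (hu a))
    -- Hence `x` agrees with a relation `y` up to shorter terms.
    obtain ⟨y, hy, hyx⟩ := exists_lengthPart_eq hxR wt
    have hyb := filteredRel_le_columnBelow hy
    have hyc := columnBelow_le_column hyb
    have hv : ∀ a : Quiver.Star i,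
        u a + σ i a • (starElt k (revStar a) * y) ∈ filteredRel σ wt o n a.1 := by
      intro a
      refine ih (add_mem (hu a) (Submodule.smul_mem _ _
        (starElt_mul_mem_filteredRel (revStar a) hy))) ?_
      rw [map_add, map_smul, lengthPart_starElt_mul (revStar a) hyc, hyx, htop a]
    have hmesh : mesh σ wt i * (x - y) ∈ filteredRel σ wt o (n + 1) i := by
      cases n with
      | zero =>
        rw [columnBelow_zero, Submodule.mem_bot] at hx hyb
        rw [hx, hyb, sub_self, mul_zero]
        exact zero_mem _
      | succ n =>
        refine mesh_mul_mem_meshSpan (mem_columnBelow_of_lengthPart_eq_zero (sub_mem hx hyb) ?_)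
        rw [map_sub, hyx, sub_self]
    have hsplit : ∑ a : Quiver.Star i, starElt k a * u a + mesh σ wt i * x =
        ∑ a : Quiver.Star i, starElt k a * (u a + σ i a • (starElt k (revStar a) * y)) +
          mesh σ wt i * (x - y) - wt i • y := by
      simp only [mul_sub, mul_add, Finset.sum_add_distrib, mesh_mul σ wt hyc]
      abel
    rw [hsplit]
    exact sub_mem (add_mem (sum_mem fun a _ => starElt_mul_mem_filteredRel a (hv a)) hmesh)
      (Submodule.smul_mem _ _ (filteredRel_le_succ hy))

/-- The joint kernel of the arrows in the column `o` of the deformed algebra is trivial. -/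
theorem mem_filteredRel_of_forall_mul_mem (hσ : ∀ i a, σ i a ≠ 0)
    (H : ∀ n, Expanding σ o δ n) (hδ : ∀ i, 0 < δ i) {x : PathAlgebra k W}
    (hx : x ∈ columnBelow k o n i)
    (h : ∀ a : Quiver.Star i, starElt k (revStar a) * x ∈ filteredRel σ wt o (n + 1) a.1) :
    x ∈ filteredRel σ wt o n i := by
  induction n generalizing x with
  | zero => rwa [columnBelow_zero] at hx
  | succ n ih =>
    have hxc := columnBelow_le_column hx
    obtain ⟨y, hy, hyx⟩ := exists_lengthPart_eq (σ := σ) (n := n + 1) (r := lengthPart k (n + 1) x)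
      ((H (n + 1)).mem_gradedRel hδ (lengthPart_mem hxc) fun a => by
        rw [← lengthPart_starElt_mul (revStar a) hxc]
        exact lengthPart_mem_gradedRel (h a)) wt
    have hyc := columnBelow_le_column (filteredRel_le_columnBelow hy)
    have hxy : lengthPart k (n + 1) (x - y) = 0 := by rw [map_sub, hyx, sub_self]
    have := ih (x := x - y) (mem_columnBelow_of_lengthPart_eq_zero
      (sub_mem hx (filteredRel_le_columnBelow hy)) hxy) fun a => by
        refine mem_filteredRel_of_lengthPart_eq_zero hσ H hδ ?_ ?_
        · rw [mul_sub]
          exact sub_mem (h a) (starElt_mul_mem_filteredRel (revStar a) hy)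
        · rw [lengthPart_starElt_mul (revStar a) (sub_mem hxc hyc), hxy, mul_zero]
    simpa using add_mem (filteredRel_le_succ this) hy

end

end PathAlgebra

namespace ExtendedDynkinType

/-! ### Extended Dynkin graphs -/

theorem sum_add_sum_le_sum_adjacency (T : ExtendedDynkinType) {d : ℕ → ℤ} (hd : ∀ m, 0 < d m)
    (i : ℕ) (S S' : Finset ℕ) (hS : ∀ m ∈ S, m ≤ T.rank ∧ T.Edge i m)
    (hS' : ∀ m ∈ S', m ≤ T.rank ∧ T.Edge m i) :
    ∑ m ∈ S, d m + ∑ m ∈ S', d m ≤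
      ∑ m ∈ Finset.range (T.rank + 1), (T.adjacency i m : ℤ) * d m := by
  classical
  have key : ∀ (P : ℕ → Prop) (S : Finset ℕ), (∀ m ∈ S, m ≤ T.rank ∧ P m) →
      ∑ m ∈ S, d m ≤ ∑ m ∈ Finset.range (T.rank + 1), (if P m then 1 else 0) * d m := by
    intro P S hS
    simp only [ite_mul, one_mul, zero_mul, ← Finset.sum_filter]
    refine Finset.sum_le_sum_of_subset_of_nonneg (fun m hm => ?_) fun m _ _ => (hd m).le
    rw [Finset.mem_filter, Finset.mem_range, Nat.lt_succ_iff]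
    exact hS m hm
  calc _ ≤ _ := add_le_add (key _ S hS) (key _ S' hS')
    _ = _ := by
      rw [← Finset.sum_add_distrib]
      refine Finset.sum_congr rfl fun m _ => ?_
      rw [adjacency, ← add_mul]
      push_cast
      rfl

/-- The adjacency matrix of an extended Dynkin graph satisfies `A d ≥ 2 d` for a positive vector
`d`, namely for the minimal positive imaginary root. -/
theorem exists_two_mul_le_sum_adjacency (T : ExtendedDynkinType) :
    ∃ d : ℕ → ℤ, (∀ m, 0 < d m) ∧ ∀ i ≤ T.rank,
      2 * d i ≤ ∑ m ∈ Finset.range (T.rank + 1), (T.adjacency i m : ℤ) * d m := by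
  cases T with
  | A n hn =>
    refine ⟨fun _ => 1, fun _ => one_pos, fun i hi => ?_⟩
    change i ≤ n at hi
    refine le_trans ?_ (sum_add_sum_le_sum_adjacency (A n hn) (fun _ => one_pos) i
      {if i = n then 0 else i + 1} {if i = 0 then n else i - 1} ?_ ?_)
    · simp
    · simp only [Finset.mem_singleton, forall_eq, rank, Edge]
      split_ifs <;> lia
    · simp only [Finset.mem_singleton, forall_eq, rank, Edge]
      split_ifs <;> lia
  | D n hn =>
    have hd : ∀ m, (0 : ℤ) < if m ≤ 1 ∨ n ≤ m + 1 then 1 else 2 := by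
      intro m; split_ifs <;> norm_num
    refine ⟨_, hd, fun i hi => ?_⟩
    change i ≤ n at hi
    refine le_trans ?_ (sum_add_sum_le_sum_adjacency (D n hn) hd i
      (if i ≤ 1 then {2} else if i + 2 = n then {n - 1, n} else if i + 2 < n then {i + 1} else ∅)
      (if n ≤ i + 1 then {n - 2} else if i = 2 then {0, 1} else if 2 < i then {i - 1} else ∅)
      ?_ ?_)
    · by_cases h1 : i ≤ 1
      · have h2 : ¬ n ≤ i + 1 := by lia
        have h3 : i ≠ 2 := by lia
        have h4 : ¬ 2 < i := by lia
        have h5 : ¬ n ≤ 3 := by lia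
        simp [h1, h2, h3, h4, h5]
      · by_cases h2 : n ≤ i + 1
        · have h3 : ¬ i + 2 = n := by lia
          have h4 : ¬ i + 2 < n := by lia
          have h5 : ¬ n - 2 ≤ 1 := by lia
          have h6 : ¬ n ≤ n - 2 + 1 := by lia
          simp [h1, h2, h3, h4, h5, h6]
        · have hout : (2 : ℤ) ≤ ∑ m ∈ (if i ≤ 1 then ({2} : Finset ℕ) else if i + 2 = n then
              {n - 1, n} else if i + 2 < n then {i + 1} else ∅),
              if m ≤ 1 ∨ n ≤ m + 1 then 1 else 2 := by
            rw [if_neg h1]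
            by_cases h3 : i + 2 = n
            · rw [if_pos h3, Finset.sum_pair (by lia), if_pos (by lia), if_pos (by lia)]
              norm_num
            · rw [if_neg h3, if_pos (by lia), Finset.sum_singleton, if_neg (by lia)]
          have hin : (2 : ℤ) ≤ ∑ m ∈ (if n ≤ i + 1 then ({n - 2} : Finset ℕ) else if i = 2 then
              {0, 1} else if 2 < i then {i - 1} else ∅),
              if m ≤ 1 ∨ n ≤ m + 1 then 1 else 2 := by
            rw [if_neg h2]
            by_cases h3 : i = 2
            · rw [if_pos h3, Finset.sum_pair (by lia), if_pos (by lia), if_pos (by lia)]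
              norm_num
            · rw [if_neg h3, if_pos (by lia), Finset.sum_singleton, if_neg (by lia)]
          rw [if_neg (by lia : ¬ (i ≤ 1 ∨ n ≤ i + 1))]
          linarith
    · intro m hm
      simp only [rank, Edge]
      split_ifs at hm <;> simp at hm <;> lia
    · intro m hm
      simp only [rank, Edge]
      split_ifs at hm <;> simp at hm <;> lia
  | E6 =>
    refine ⟨fun m => if m = 4 then 3 else if m = 1 ∨ m = 3 ∨ m = 5 then 2 else 1,
      fun m => by dsimp only; split_ifs <;> norm_num, fun i hi => ?_⟩
    change i ≤ 6 at hi
    interval_cases i <;> simp [rank, adjacency, Edge, Finset.sum_range_succ]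
  | E7 =>
    refine ⟨fun m => if m < 4 then m + 1 else if m < 7 then 7 - m else 2,
      fun m => by dsimp only; split_ifs <;> lia, fun i hi => ?_⟩
    change i ≤ 7 at hi
    interval_cases i <;> simp [rank, adjacency, Edge, Finset.sum_range_succ]
  | E8 =>
    refine ⟨fun m => if m < 6 then m + 1 else if m < 8 then 16 - 2 * m else 3,
      fun m => by dsimp only; split_ifs <;> lia, fun i hi => ?_⟩
    change i ≤ 8 at hi
    interval_cases i <;> simp [rank, adjacency, Edge, Finset.sum_range_succ]

end ExtendedDynkinType

theorem IsExtendedDynkin.exists_two_mul_le_sum {V : Type*} [Quiver V] [Fintype V]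
    [∀ a b : V, Fintype (a ⟶ b)] {o : V} (h : IsExtendedDynkin V o) :
    ∃ δ : V → ℤ, (∀ i, 0 < δ i) ∧ ∀ i, 2 * δ i ≤ ∑ a : EdgeAt i, δ a.1 := by
  obtain ⟨T, φ, -, hφ⟩ := h
  obtain ⟨d, hd, hA⟩ := T.exists_two_mul_le_sum_adjacency
  refine ⟨fun i => d (φ i), fun i => hd _, fun i => ?_⟩
  refine (hA (φ i) (Nat.lt_succ_iff.1 (φ i).2)).trans (le_of_eq ?_)
  rw [Finset.sum_range fun m => (T.adjacency (φ i) m : ℤ) * d m, ← φ.sum_comp, Fintype.sum_sigma]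
  refine Finset.sum_congr rfl fun j _ => ?_
  rw [← hφ]
  simp [Fintype.card_sum]

namespace PathAlgebra

/-! ### The ideal generated by the mesh relations -/

section

variable {k W : Type*} [Field k] [Quiver W] [Quiver.HasReverse W] [Fintype W]
  [∀ a b : W, Fintype (a ⟶ b)] {σ : ∀ i : W, Quiver.Star i → k} {wt : W → k} {o i : W}

theorem mem_span_mesh_of_mem_filteredRel {n : ℕ} {z : PathAlgebra k W}
    (hz : z ∈ filteredRel σ wt o n i) : z ∈ TwoSidedIdeal.span (Set.range (mesh σ wt)) := by
  induction n using Nat.twoStepInduction generalizing i z with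
  | zero =>
    rw [filteredRel, Submodule.mem_bot] at hz
    rw [hz]; exact zero_mem _
  | one =>
    rw [filteredRel, Submodule.mem_bot] at hz
    rw [hz]; exact zero_mem _
  | more n _ ih =>
    obtain ⟨u, hu, x, -, rfl⟩ := mem_meshSpan.1 hz
    exact add_mem (sum_mem fun a _ => TwoSidedIdeal.mul_mem_left _ _ _ (ih (hu a)))
      (TwoSidedIdeal.mul_mem_right _ _ _ (TwoSidedIdeal.subset_span ⟨i, rfl⟩))

theorem exists_add_mem_filteredRel {x y : PathAlgebra k W}
    (hx : ∃ n, x ∈ filteredRel σ wt o n i) (hy : ∃ n, y ∈ filteredRel σ wt o n i) :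
    ∃ n, x + y ∈ filteredRel σ wt o n i := by
  obtain ⟨m, hm⟩ := hx
  obtain ⟨n, hn⟩ := hy
  exact ⟨max m n, add_mem (filteredRel_mono (le_max_left m n) hm)
    (filteredRel_mono (le_max_right m n) hn)⟩

theorem ofPath_mul_mem_filteredRel {j : W} (p : Quiver.Path i j) {z : PathAlgebra k W}
    (hz : ∃ n, z ∈ filteredRel σ wt o n j) : ∃ n, ofPath p * z ∈ filteredRel σ wt o n i := by
  induction p generalizing z with
  | nil =>
    obtain ⟨n, hn⟩ := hz
    refine ⟨n, ?_⟩
    have := idem_mul (columnBelow_le_column (filteredRel_le_columnBelow hn))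
    rw [idem] at this
    rwa [this]
  | @cons b c p f ih =>
    obtain ⟨n, hn⟩ := hz
    have e : (ofPath (p.cons f) : PathAlgebra k W) = ofPath p * starElt k ⟨c, f⟩ :=
      (ofPath_mul_ofPath p f.toPath).symm
    rw [e, mul_assoc]
    exact ih ⟨n + 1, starElt_mul_mem_filteredRel ⟨c, f⟩ hn⟩

theorem idem_mul_mul_mem_filteredRel {j : W} (x : PathAlgebra k W) {z : PathAlgebra k W}
    (hz : ∃ n, z ∈ filteredRel σ wt o n j) :
    ∃ n, idem i * (x * z) ∈ filteredRel σ wt o n i := by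
  induction x using PathAlgebra.induction with
  | zero => exact ⟨0, by rw [zero_mul, mul_zero]; exact zero_mem _⟩
  | add x y hx hy =>
    rw [add_mul, mul_add]
    exact exists_add_mem_filteredRel hx hy
  | smul c a b p =>
    suffices h : ∃ n, idem i * (ofPath p * z) ∈ filteredRel σ wt o n i by
      obtain ⟨n, hn⟩ := h
      refine ⟨n, ?_⟩
      rw [smul_mul_assoc, mul_smul_comm]
      exact Submodule.smul_mem _ _ hn
    by_cases ha : i = a
    · subst ha
      by_cases hb : b = j
      · subst hb
        exact ofPath_mul_mem_filteredRel Quiver.Path.nil (ofPath_mul_mem_filteredRel p hz)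
      · obtain ⟨n, hn⟩ := hz
        rw [← idem_mul (columnBelow_le_column (filteredRel_le_columnBelow hn)),
          ← mul_assoc (ofPath p), idem, idem, ofPath_mul_of_ne p _ hb, zero_mul, mul_zero]
        exact ⟨0, zero_mem _⟩
    · rw [← mul_assoc, idem, ofPath_mul_of_ne _ p ha, zero_mul]
      exact ⟨0, zero_mem _⟩

/-- The column `o` of the ideal generated by the mesh relations is the union of the spaces
`filteredRel`. -/
theorem exists_mem_filteredRel {z : PathAlgebra k W}
    (hz : z ∈ TwoSidedIdeal.span (Set.range (mesh σ wt))) (o i : W) :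
    ∃ n, idem i * z * idem o ∈ filteredRel σ wt o n i := by
  rw [TwoSidedIdeal.mem_span_iff_mem_addSubgroup_closure] at hz
  induction hz using AddSubgroup.closure_induction with
  | mem z hz =>
    obtain ⟨_, ⟨x, -, _, ⟨j, rfl⟩, rfl⟩, y, -, rfl⟩ := hz
    obtain ⟨n, hn⟩ := exists_mem_columnBelow (idem_mul_mul_mem_column o j y)
    have hmesh : mesh σ wt j * idem j = mesh σ wt j := by
      rw [mesh, sub_mul, Finset.sum_mul, smul_mul_assoc, idem_mul_idem]
      congr 1
      refine Finset.sum_congr rfl fun a _ => ?_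
      rw [smul_mul_assoc, mul_assoc]
      congr 2
      exact ofPath_mul_ofPath _ _
    have := idem_mul_mul_mem_filteredRel (i := i) x
      ⟨n + 2, mesh_mul_mem_meshSpan (σ := σ) (wt := wt)
        (Y := filteredRel σ wt o (n + 1)) hn⟩
    obtain ⟨m, hm⟩ := this
    refine ⟨m, ?_⟩
    have e1 : idem i * (x * mesh σ wt j * y) * idem o =
        idem i * (x * (mesh σ wt j * (idem j * y * idem o))) := by
      rw [← hmesh]
      simp only [mul_assoc]
      rw [← mul_assoc (idem j) (idem j), idem_mul_idem]
    exact e1 ▸ hm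
  | zero => exact ⟨0, by simp⟩
  | add x y _ _ hx hy =>
    rw [mul_add, add_mul]
    exact exists_add_mem_filteredRel hx hy
  | neg x _ hx =>
    obtain ⟨n, hn⟩ := hx
    exact ⟨n, by rw [mul_neg, neg_mul]; exact neg_mem hn⟩

theorem sum_starElt_mul_mem_span_mesh (hwt : wt i = 0) {x : PathAlgebra k W}
    (hx : x ∈ column k o i) :
    ∑ a : Quiver.Star i, starElt k a * (σ i a • (starElt k (revStar a) * x)) ∈
      TwoSidedIdeal.span (Set.range (mesh σ wt)) := by
  have h := mesh_mul σ wt hx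
  rw [hwt, zero_smul, sub_zero] at h
  rw [← h]
  exact TwoSidedIdeal.mul_mem_right _ _ _ (TwoSidedIdeal.subset_span ⟨i, rfl⟩)

/-- The mesh relation at `i` is, up to the other relations, the only relation among the arrows
with tail `i`. -/
theorem exists_sub_mem_filteredRel (hwt : wt i = 0) {z : Quiver.Star i → PathAlgebra k W}
    (hz : ∀ a, z a ∈ column k o a.1)
    (h : ∃ n, ∑ a, starElt k a * z a ∈ filteredRel σ wt o n i) :
    ∃ x ∈ column k o i, ∀ a, ∃ n,
      z a - σ i a • (starElt k (revStar a) * x) ∈ filteredRel σ wt o n a.1 := by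
  obtain ⟨n, hn⟩ := h
  -- The index may be raised to `n + 2`, where `filteredRel` is given by its recursion.
  obtain ⟨u, hu, x, hx, hux⟩ := mem_meshSpan.1 (filteredRel_mono (Nat.le_add_right n 2) hn)
  have hxc := columnBelow_le_column hx
  have huc := fun a => columnBelow_le_column (filteredRel_le_columnBelow (hu a))
  rw [mesh_mul σ wt hxc, hwt, zero_smul, sub_zero, ← Finset.sum_add_distrib] at hux
  have hsub := sub_eq_zero.2 hux
  rw [← Finset.sum_sub_distrib] at hsub
  simp only [← mul_add, ← mul_sub] at hsub
  have key := eq_zero_of_sum_starElt_mul_eq_zero (o := o) (fun a =>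
    sub_mem (hz a) (add_mem (huc a) (smul_rev_mul_mem_column σ a hxc))) hsub
  refine ⟨x, hxc, fun a => ⟨n + 1, ?_⟩⟩
  rw [sub_eq_zero.1 (key a), add_sub_cancel_right]
  exact hu a

end

section

variable {k W : Type*} [Field k] [Quiver W] [Quiver.HasInvolutiveReverse W] [Fintype W]
  [∀ a b : W, Fintype (a ⟶ b)] {σ : ∀ i : W, Quiver.Star i → k} {wt : W → k} {o i : W}

/-- The joint kernel of the signed arrows is trivial in the whole column, with no bound on the
length of the paths. -/
theorem exists_mem_filteredRel_of_forall {δ : W → ℤ} (hσ : ∀ i a, σ i a ≠ 0)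
    (hδ : ∀ i, 0 < δ i) (hA : ∀ i, 2 * δ i ≤ ∑ a : Quiver.Star i, δ a.1) {x : PathAlgebra k W}
    (hx : x ∈ column k o i)
    (h : ∀ a : Quiver.Star i, ∃ n,
      σ i a • (starElt k (revStar a) * x) ∈ filteredRel σ wt o n a.1) :
    ∃ n, x ∈ filteredRel σ wt o n i := by
  choose n hn using h
  obtain ⟨m, hm⟩ := exists_mem_columnBelow hx
  refine ⟨m + ∑ a, n a, mem_filteredRel_of_forall_mul_mem hσ (expanding hσ hδ hA) hδ
    (columnBelow_mono (Nat.le_add_right _ _) hm) fun a => ?_⟩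
  refine (Submodule.smul_mem_iff _ (hσ i a)).1 (filteredRel_mono ?_ (hn a))
  have := Finset.single_le_sum (f := n) (fun _ _ => Nat.zero_le _) (Finset.mem_univ a)
  lia

end

end PathAlgebra

namespace DeformedPreprojective

/-! ### The vertex modules -/

section

variable {k V : Type*} [Field k] [Quiver V]

instance [H : ∀ a b : V, Fintype (a ⟶ b)] (a b : Quiver.Symmetrify V) : Fintype (a ⟶ b) :=
  @instFintypeSum _ _ (H a b) (H b a)

/-- The sign with which an edge at `i` enters the relation at `i`: `1` if the arrow of `V` starts
at `i` and `-1` if it ends there. -/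
def edgeSign (k : Type*) [Field k] (i : Quiver.Symmetrify V) (a : Quiver.Star i) : k :=
  Sum.elim (fun _ => 1) (fun _ => -1) a.2

theorem edgeSign_ne_zero (i : Quiver.Symmetrify V) (a : Quiver.Star i) : edgeSign k i a ≠ 0 := by
  obtain ⟨j, f | f⟩ := a
  · exact one_ne_zero
  · exact neg_ne_zero.2 one_ne_zero

variable [Fintype V]

theorem mesh_edgeSign [H : ∀ a b : V, Fintype (a ⟶ b)] (wt : V → k) (i : Quiver.Symmetrify V) :
    PathAlgebra.mesh (W := Quiver.Symmetrify V) (edgeSign k) wt i = relation (V := V) wt i := by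
  unfold PathAlgebra.mesh relation
  rw [Fintype.sum_sigma, ← Finset.sum_sub_distrib]
  congr 1
  refine Finset.sum_congr rfl fun j _ => ?_
  refine (@Fintype.sum_sum_type (@Quiver.Hom V _ i j) (@Quiver.Hom V _ j i) _ (H i j) (H j i) _
    _).trans ?_
  rw [sub_eq_add_neg, ← Finset.sum_neg_distrib]
  congr 1
  · refine Finset.sum_congr rfl fun f _ => ?_
    exact one_smul k _
  · refine Finset.sum_congr rfl fun f _ => ?_
    exact neg_one_smul k _

variable [∀ a b : V, Fintype (a ⟶ b)] {wt : V → k} {o i j : V}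

theorem mk_surjective : Function.Surjective (mk wt) := RingCon.mk'_surjective _

theorem mk_eq_zero_iff {z : PathAlgebra k (Quiver.Symmetrify V)} :
    mk wt z = 0 ↔ z ∈ relationIdeal wt := by
  rw [TwoSidedIdeal.mem_iff]
  exact RingCon.eq _

theorem relationIdeal_eq_span_mesh : relationIdeal wt = TwoSidedIdeal.span
    (Set.range (PathAlgebra.mesh (W := Quiver.Symmetrify V) (edgeSign k) wt)) :=
  congrArg (fun r => TwoSidedIdeal.span (Set.range r)) (funext (mesh_edgeSign wt)).symm

theorem mk_eq_zero_iff_exists {z : PathAlgebra k (Quiver.Symmetrify V)}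
    (hz : z ∈ PathAlgebra.column k (W := Quiver.Symmetrify V) o i) :
    mk wt z = 0 ↔
      ∃ n, z ∈ PathAlgebra.filteredRel (W := Quiver.Symmetrify V) (edgeSign k) wt o n i := by
  rw [mk_eq_zero_iff, relationIdeal_eq_span_mesh]
  constructor
  · intro h
    have := PathAlgebra.exists_mem_filteredRel h o i
    rwa [PathAlgebra.idem_mul hz, PathAlgebra.mul_idem hz] at this
  · rintro ⟨n, hn⟩
    exact PathAlgebra.mem_span_mesh_of_mem_filteredRel hn

theorem mem_vertexModule_iff {x : DeformedPreprojective wt} :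
    x ∈ VertexModule wt o i ↔
      ∃ z ∈ PathAlgebra.column k (W := Quiver.Symmetrify V) o i, mk wt z = x := by
  constructor
  · rintro ⟨r, rfl⟩
    obtain ⟨r, rfl⟩ := mk_surjective r
    exact ⟨_, PathAlgebra.idem_mul_mul_mem_column _ _ r, by rw [map_mul, map_mul]; rfl⟩
  · rintro ⟨z, hz, rfl⟩
    refine ⟨mk wt z, ?_⟩
    rw [e, e, ← map_mul, ← map_mul, PathAlgebra.idem_mul hz, PathAlgebra.mul_idem hz]

/-- Left multiplication by an element of `e_i Π^λ`, as a map of right modules `V_j → V_i`. -/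
noncomputable def leftMul (o j : V) (z : DeformedPreprojective wt) (hz : e wt i * z = z) :
    VertexModule wt o j →ₗ[(CornerAlgebra wt o)ᵐᵒᵖ] VertexModule wt o i where
  toFun x := ⟨z * x, by
    obtain ⟨r, hr⟩ := x.2
    refine ⟨z * (e wt j * r), ?_⟩
    rw [hr, ← mul_assoc (e wt i), hz]
    simp only [mul_assoc]⟩
  map_add' x y := Subtype.ext (mul_add z x.1 y.1)
  map_smul' r x := Subtype.ext (mul_assoc z x.1 r.unop.1).symm

/-- The map `V_k → V_i` given by an edge `i — k`: left multiplication by the arrow from `i` to `k`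
in the double. -/
noncomputable def alongEdge (wt : V → k) (o : V) {i : V} (a : EdgeAt i) :
    VertexModule wt o a.1 →ₗ[(CornerAlgebra wt o)ᵐᵒᵖ] VertexModule wt o i :=
  leftMul o a.1 (mk wt (PathAlgebra.starElt (W := Quiver.Symmetrify V) (i := i) k a))
    (by rw [e, ← map_mul]; exact congrArg (mk wt) (PathAlgebra.idem_mul_starElt _))

/-- The map `V_i → V_k` given by an edge `i — k`: left multiplication by the arrow from `k` to `i`
in the double, with the sign of the edge. -/
noncomputable def againstEdge (wt : V → k) (o : V) {i : V} (a : EdgeAt i) :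
    VertexModule wt o i →ₗ[(CornerAlgebra wt o)ᵐᵒᵖ] VertexModule wt o a.1 :=
  leftMul o i (mk wt (edgeSign k i a • PathAlgebra.starElt (W := Quiver.Symmetrify V) k
    (PathAlgebra.revStar (W := Quiver.Symmetrify V) (i := i) a))) (by
      rw [e, ← map_mul, mul_smul_comm]
      congr 2
      exact PathAlgebra.idem_mul_starElt _)

theorem coe_alongEdge (a : EdgeAt i) (x : VertexModule wt o a.1) :
    (alongEdge wt o a x : DeformedPreprojective wt) =
      mk wt (PathAlgebra.starElt (W := Quiver.Symmetrify V) (i := i) k a) * x := rfl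

theorem coe_againstEdge (a : EdgeAt i) (x : VertexModule wt o i) :
    (againstEdge wt o a x : DeformedPreprojective wt) =
      mk wt (edgeSign k i a • PathAlgebra.starElt (W := Quiver.Symmetrify V) k
        (PathAlgebra.revStar (W := Quiver.Symmetrify V) (i := i) a)) * x := rfl

/-- Every element of `V_i` with `i ≠ o` is a combination of paths of positive length. -/
theorem exists_sum_alongEdge_eq (hi : i ≠ o) (x : VertexModule wt o i) :
    ∃ y : ∀ a : EdgeAt i, VertexModule wt o a.1, ∑ a, alongEdge wt o a (y a) = x := by
  obtain ⟨z, hz, hzx⟩ := mem_vertexModule_iff.1 x.2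
  obtain ⟨y, hy, rfl⟩ := PathAlgebra.exists_eq_sum_of_ne (W := Quiver.Symmetrify V) hi hz
  refine ⟨fun a => ⟨mk wt (y a), mem_vertexModule_iff.2 ⟨y a, hy a, rfl⟩⟩, Subtype.ext ?_⟩
  rw [← hzx, map_sum, AddSubgroup.val_finsetSum]
  refine Finset.sum_congr rfl fun a _ => ?_
  rw [coe_alongEdge, map_mul]

theorem sum_alongEdge_againstEdge (hwt : wt i = 0) (x : VertexModule wt o i) :
    ∑ a : EdgeAt i, alongEdge wt o a (againstEdge wt o a x) = 0 := by
  obtain ⟨z, hz, hzx⟩ := mem_vertexModule_iff.1 x.2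
  have h := mk_eq_zero_iff.2 (relationIdeal_eq_span_mesh (wt := wt) ▸
    PathAlgebra.sum_starElt_mul_mem_span_mesh (W := Quiver.Symmetrify V)
      (σ := edgeSign k) hwt hz)
  rw [map_sum] at h
  refine Subtype.ext ?_
  rw [AddSubgroup.val_finsetSum]
  refine Eq.trans (Finset.sum_congr rfl fun a _ => ?_) h
  rw [coe_alongEdge, coe_againstEdge, ← hzx, ← map_mul, ← map_mul, smul_mul_assoc]

/-- The relation at `i` is the only one among the arrows with tail `i`. -/
theorem exists_againstEdge_eq (hwt : wt i = 0) {y : ∀ a : EdgeAt i, VertexModule wt o a.1}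
    (hy : ∑ a, alongEdge wt o a (y a) = 0) :
    ∃ x, ∀ a, againstEdge wt o a x = y a := by
  choose z hz hzy using fun a => mem_vertexModule_iff.1 (y a).2
  have h0 : mk wt (∑ a : EdgeAt i,
      PathAlgebra.starElt (W := Quiver.Symmetrify V) (i := i) k a * z a) = 0 := by
    have := congrArg Subtype.val hy
    rw [AddSubgroup.val_finsetSum] at this
    rw [map_sum]
    refine Eq.trans (Finset.sum_congr rfl fun a _ => ?_) this
    rw [coe_alongEdge, map_mul, hzy]
  have hcol : ∑ a : EdgeAt i, PathAlgebra.starElt (W := Quiver.Symmetrify V) (i := i) k a * z a ∈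
      PathAlgebra.column k (W := Quiver.Symmetrify V) o i := sum_mem fun a _ =>
    PathAlgebra.starElt_mul_mem_column (W := Quiver.Symmetrify V) (i := i) a (hz a)
  obtain ⟨x, hx, hxz⟩ := PathAlgebra.exists_sub_mem_filteredRel (W := Quiver.Symmetrify V)
    (σ := edgeSign k) hwt hz ((mk_eq_zero_iff_exists hcol).1 h0)
  refine ⟨⟨mk wt x, mem_vertexModule_iff.2 ⟨x, hx, rfl⟩⟩, fun a => Subtype.ext ?_⟩
  have h := (mk_eq_zero_iff_exists (o := o) (i := a.1) (sub_mem (hz a)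
    (PathAlgebra.smul_rev_mul_mem_column (W := Quiver.Symmetrify V) (edgeSign k) a hx))).2 (hxz a)
  rw [map_sub, sub_eq_zero] at h
  rw [coe_againstEdge, ← hzy, h, ← map_mul, smul_mul_assoc]

/-- Joint injectivity of the maps `V_i → V_k`, for any weight: only the positive vector `δ` with
`A δ ≥ 2 δ` is needed. -/
theorem eq_zero_of_forall_againstEdge_eq_zero {δ : V → ℤ} (hδ : ∀ i, 0 < δ i)
    (hA : ∀ i, 2 * δ i ≤ ∑ a : EdgeAt i, δ a.1) {x : VertexModule wt o i}
    (hx : ∀ a : EdgeAt i, againstEdge wt o a x = 0) : x = 0 := by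
  obtain ⟨z, hz, hzx⟩ := mem_vertexModule_iff.1 x.2
  refine Subtype.ext (hzx.symm.trans ((mk_eq_zero_iff_exists hz).2 ?_))
  refine PathAlgebra.exists_mem_filteredRel_of_forall (W := Quiver.Symmetrify V) (δ := δ)
    edgeSign_ne_zero hδ hA hz fun (a : EdgeAt i) => ?_
  have h0 := congrArg Subtype.val (hx a)
  rw [coe_againstEdge, ← hzx, ← map_mul, smul_mul_assoc] at h0
  exact (mk_eq_zero_iff_exists (o := o) (i := a.1)
    (PathAlgebra.smul_rev_mul_mem_column (W := Quiver.Symmetrify V) (edgeSign k) a hz)).1 h0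

end

end DeformedPreprojective

theorem mainTheorem9 {k V : Type*} [Field k] [IsAlgClosed k] [CharZero k]
    [Quiver V] [Fintype V] [DecidableEq V] [∀ a b : V, Fintype (a ⟶ b)]
    (o : V) (hQ : IsExtendedDynkin V o) (i : V) (hi : i ≠ o) :
    let ε : V → k := Pi.single o 1
    let O := DeformedPreprojective.CornerAlgebra ε o
    let M : V → AddSubgroup (DeformedPreprojective ε) := DeformedPreprojective.VertexModule ε o
    ∃ (f : M i →ₗ[Oᵐᵒᵖ] ⨁ a : EdgeAt i, M a.1) (g : (⨁ a : EdgeAt i, M a.1) →ₗ[Oᵐᵒᵖ] M i),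
      Function.Injective f ∧ Function.Exact f g ∧ Function.Surjective g := by
  intro ε O M
  obtain ⟨δ, hδ, hA⟩ := hQ.exists_two_mul_le_sum
  have hε : ε i = 0 := Pi.single_eq_of_ne hi 1
  let E := DirectSum.linearEquivFunOnFintype Oᵐᵒᵖ (EdgeAt i) fun a => M a.1
  let f : M i →ₗ[Oᵐᵒᵖ] ∀ a : EdgeAt i, M a.1 :=
    LinearMap.pi fun a => DeformedPreprojective.againstEdge ε o a
  let g : (∀ a : EdgeAt i, M a.1) →ₗ[Oᵐᵒᵖ] M i :=
    ∑ a, DeformedPreprojective.alongEdge ε o a ∘ₗ LinearMap.proj a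
  have hg : ∀ y, g y = ∑ a, DeformedPreprojective.alongEdge ε o a (y a) := fun y => by
    simp [g, LinearMap.sum_apply]
  have hf : Function.Injective f := (injective_iff_map_eq_zero f).2 fun x hx =>
    DeformedPreprojective.eq_zero_of_forall_againstEdge_eq_zero hδ hA fun a => congrFun hx a
  have hfg : Function.Exact f g := fun y => by
    rw [hg]
    constructor
    · intro hy
      obtain ⟨x, hx⟩ := DeformedPreprojective.exists_againstEdge_eq hε hy
      exact ⟨x, funext hx⟩
    · rintro ⟨x, rfl⟩
      exact DeformedPreprojective.sum_alongEdge_againstEdge hε x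
  have hgs : Function.Surjective g := fun x => by
    obtain ⟨y, hy⟩ := DeformedPreprojective.exists_sum_alongEdge_eq hi x
    exact ⟨y, (hg y).trans hy⟩
  refine ⟨E.symm.toLinearMap ∘ₗ f, g ∘ₗ E.toLinearMap, E.symm.injective.comp hf, fun y => ?_,
    hgs.comp E.surjective⟩
  refine (hfg (E y)).trans ?_
  constructor
  · rintro ⟨x, hx⟩
    exact ⟨x, (E.symm_apply_eq).2 hx⟩
  · rintro ⟨x, hx⟩
    exact ⟨x, (E.symm_apply_eq).1 hx⟩
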